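/- Let $p\ge 2$ be an integer and let $G,H$ be probability distributions on $(0,\infty)$ with $\int v^{-p/2}\,dG(v)<\infty$ and $\int w^{-p/2}\,dH(w)<\infty$. For a distribution $F$ on $(0,\infty)$ write $$f_F(s)=\int_{(0,\infty)}(2\pi v)^{-p/2}e^{-\|s\|^2/(2v)}\,dF(v),\qquad s\in\mathbb R^p ,$$ and let $p_X=f_G$, $q_Y=f_H$. Let $X$ have density $p_X(x-\mu)$, $\mu\in\mathbb R^p$ unknown. An estimator $\hat q(y;X)$ of the density $q_Y(y-\mu)$, $y\in\mathbb R^p$, is assessed by its risk $E_\mu\int_{\mathbb R^p}|\hat q(y;X)-q_Y(y-\mu)|\,dy$ under integrated $L_1$ loss. A procedure dominates another one if its risk is at most that of the other for every $\mu\in\mathbb R^p$ and strictly smaller for at least one $\mu$. Let $$Z=\frac{4Z_1Z_2}{Z_1+4Z_2},\qquad (Z_1,Z_2)\sim d\tau(z_1,z_2)\ \propto\ \frac{z_2^{(p-1)/2}}{(z_1+4z_2)^{p/2}}\,dG(z_1)\,dH(z_2),$$ let $F_Z$ be the distribution of $Z$, and let $$p^*(s)=\frac{K}{\|s\|}\int_{(0,\infty)}(2\pi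 z)^{-p/2}e^{-\|s\|^2/(2z)}\,dF_Z(z),\qquad s\in\mathbb R^p\setminus\{0\},$$ where $K$ is the normalizing constant. (a) The density $p^*$ is itself a scale mixture of normals: there is a probability distribution $J$ on $(0,\infty)$ with $p^*(s)=f_J(s)$ for all $s\ne 0$. Let $\hat\mu:\mathbb R^p\to\mathbb R^p$ be measurable and suppose that, for $X'$ with density $p^*(x-\mu)$ and under the loss $\|\hat\mu-\mu\|^2$, the estimator $X'$ has finite risk and $\hat\mu(X')$ dominates $X'$. Then the plug-in density estimator $q_Y(y-\hat\mu(X))$ dominates the plug-in density estimator $q_Y(y-X)$. (b) Let $p\ge 4$, let $E(Z^{1/2})$ and $E(Z^{-3/2})$ be finite, and let $r$ be a real function on $(0,\infty)$ with $0\le r\le 1$ and $r\not\equiv 0$ such that $r(t)$ is non-decreasing and $r(t)/t$ is non-increasing in $t>0$. If $$0<a\le 2(p-3)\,\frac{E(Z^{-1/2})}{E(Z^{-3/2})},$$ then, with $\hat\mu_{a,r}(x)=\Bigl(1-a\,\frac{r(\|x\|^2)}{\|x\|^2}\Bigr)x$, the plug-in density estimator $q_Y(y-\hat\mu_{a,r}(X))$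 dominates the plug-in density estimator $q_Y(y-X)$. -/

import Mathlib

open MeasureTheory
open scoped ENNReal

noncomputable section

/-- The scale mixture of normals on `ℝ^p` with mixing distribution `G` for the variance:
`x ↦ ∫ (2πv)^(-p/2) exp(-‖x‖² / (2v)) dG(v)`. -/
def snDensity (p : ℕ) (G : Measure ℝ) (x : EuclideanSpace ℝ (Fin p)) : ℝ :=
  ∫ v, (2 * Real.pi * v) ^ (-(p : ℝ) / 2) * Real.exp (-‖x‖ ^ 2 / (2 * v)) ∂G

/-- Admissible mixing distributions in dimension `p`: laws of a positive random variable `V` with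
`E(V^(-p/2)) < ∞`. -/
structure IsMixing (p : ℕ) (G : Measure ℝ) : Prop where
  isProb : IsProbabilityMeasure G
  pos : ∀ᵐ v ∂G, 0 < v
  integrable : Integrable (fun v : ℝ => v ^ (-(p : ℝ) / 2)) G

/-- The law with Lebesgue density `x ↦ f (x - μ)`. -/
def locationLaw {p : ℕ} (f : EuclideanSpace ℝ (Fin p) → ℝ) (μ : EuclideanSpace ℝ (Fin p)) :
    Measure (EuclideanSpace ℝ (Fin p)) :=
  volume.withDensity fun x => ENNReal.ofReal (f (x - μ))

/-- Risk at `μ`, under integrated `L¹` loss and for `X` with density `f (x - μ)`, of the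
predictive density estimator `qhat` (`qhat x y` is the estimate at `y` when `X = x`) of the density
`y ↦ q (y - μ)`. -/
def l1Risk {p : ℕ} (f q : EuclideanSpace ℝ (Fin p) → ℝ)
    (qhat : EuclideanSpace ℝ (Fin p) → EuclideanSpace ℝ (Fin p) → ℝ)
    (μ : EuclideanSpace ℝ (Fin p)) : ℝ≥0∞ :=
  ∫⁻ x, (∫⁻ y, ENNReal.ofReal |qhat x y - q (y - μ)|) ∂(locationLaw f μ)

/-- The plug-in density estimator `q (y - δ X)`. -/
def plugIn {p : ℕ} (q : EuclideanSpace ℝ (Fin p) → ℝ)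
    (δ : EuclideanSpace ℝ (Fin p) → EuclideanSpace ℝ (Fin p)) :
    EuclideanSpace ℝ (Fin p) → EuclideanSpace ℝ (Fin p) → ℝ :=
  fun x y => q (y - δ x)

/-- Risk at `μ` of the point estimator `δ` of `μ` under squared error loss, for `X` with density
`f (x - μ)`. -/
def sqRisk {p : ℕ} (f : EuclideanSpace ℝ (Fin p) → ℝ)
    (δ : EuclideanSpace ℝ (Fin p) → EuclideanSpace ℝ (Fin p))
    (μ : EuclideanSpace ℝ (Fin p)) : ℝ≥0∞ :=
  ∫⁻ x, ENNReal.ofReal (‖δ x - μ‖ ^ 2) ∂(locationLaw f μ)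

/-- A procedure with risk function `R` dominates one with risk function `R'`. -/
def Dominates {Θ : Type*} (R R' : Θ → ℝ≥0∞) : Prop :=
  (∀ θ, R θ ≤ R' θ) ∧ ∃ θ, R θ < R' θ

/-- The unnormalized density of `τ` with respect to `G ⊗ H`:
`z₂^((p-1)/2) / (z₁ + 4 z₂)^(p/2)`. -/
def tauWeight (p : ℕ) (z : ℝ × ℝ) : ℝ≥0∞ :=
  ENNReal.ofReal (z.2 ^ (((p : ℝ) - 1) / 2) / (z.1 + 4 * z.2) ^ ((p : ℝ) / 2))

/-- The joint law `τ` of `(Z₁, Z₂)`, normalized to total mass one. -/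
def tau (p : ℕ) (G H : Measure ℝ) : Measure (ℝ × ℝ) :=
  (∫⁻ z, tauWeight p z ∂(G.prod H))⁻¹ • (G.prod H).withDensity (tauWeight p)

/-- The law of `Z = 4 Z₁ Z₂ / (Z₁ + 4 Z₂)` with `(Z₁, Z₂) ∼ τ`. -/
def lawZ (p : ℕ) (G H : Measure ℝ) : Measure ℝ :=
  (tau p G H).map fun z => 4 * z.1 * z.2 / (z.1 + 4 * z.2)

/-- The density `p*`: `s ↦ (K / ‖s‖) ∫ (2πz)^(-p/2) exp(-‖s‖² / (2z)) dF_Z(z)`, with `K` the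
normalizing constant. -/
def pStar (p : ℕ) (G H : Measure ℝ) (s : EuclideanSpace ℝ (Fin p)) : ℝ :=
  (∫ t : EuclideanSpace ℝ (Fin p), 1 / ‖t‖ * snDensity p (lawZ p G H) t)⁻¹ / ‖s‖ *
    snDensity p (lawZ p G H) s

/-- The Baranchik estimator `(1 - a r(X'X) / X'X) X`. -/
def baranchik {p : ℕ} (a : ℝ) (r : ℝ → ℝ) (x : EuclideanSpace ℝ (Fin p)) :
    EuclideanSpace ℝ (Fin p) :=
  (1 - a * r (‖x‖ ^ 2) / ‖x‖ ^ 2) • x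

end

/-! The `L¹` distance between two translates of `f_H` depends only on the distance `τ` of their
centres and is strictly concave as a function of `τ²`. For one normal law of variance `w` its
derivative in `τ²` is `φ_w(τ/2)/τ`, which decreases in `τ`, and mixing over `w` keeps this
(`mixtureL1_sub_lt`). By the tangent bound, replacing `x` by `δ x` changes the `L¹` loss by at most
`mixtureSlope H ‖x - μ‖ * (‖δ x - μ‖² - ‖x - μ‖²)`. The slope times the density of `X` is a multiple
of `p*`: Gaussian factors in `‖s‖` with variances `z₁` and `4 z₂` multiply to one with variance `Z`,
and `τ` collects the remaining powers (`exists_mixtureSlope_mul_eq_pStar`). So the `L¹` risk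
difference is at most a positive constant times the quadratic risk difference under `p*`
(`l1Risk_plugIn_comparison`), which gives (a).

`p*` is a mixture of normals because `‖s‖⁻¹` is proportional to `z^(-1/2) ∫ κ^(-1/2)
exp(-κ‖s‖²/(2z)) dκ`: multiplying the kernel of variance `z` by it averages kernels of variance
`z/(1+κ)`. Moments of the mixing law `J` then contain beta integrals, and `E_J(1/V) = (p-2)/(p-3) *
E(Z^(-3/2))/E(Z^(-1/2))`. The bound on `a` becomes `a E_J(1/V) ≤ 2(p-2)`.

For (b), condition on the variance `v` and let `m(v)` be the mean of `r(‖x‖²)/‖x‖²`. By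
`stein_inequality` the quadratic risk difference is at most `a * (v m(v)) * (a/v - 2(p-2))`. Here `v
m(v)` is non-decreasing (`mul_shrinkMean_mono`) and the last factor decreases through zero at some
`v₀`, so `v m(v)` may be replaced by `v₀ m(v₀)`; integrating over `J` gives a non-positive number.
Strictness comes from strict concavity of the `L¹` loss: equal risks would force `‖δ x - μ‖ = ‖x -
μ‖` almost everywhere, which fails at `μ = 0`. -/

/-! ### Normal kernels and their scale mixtures. -/

/-- The density of the centred normal law on `ℝ^p` with covariance matrix `v • 1`. -/
noncomputable def gaussKernel (p : ℕ) (v : ℝ) (x : EuclideanSpace ℝ (Fin p)) : ℝ :=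
  (2 * Real.pi * v) ^ (-(p : ℝ) / 2) * Real.exp (-‖x‖ ^ 2 / (2 * v))

theorem gaussKernel_nonneg {p : ℕ} {v : ℝ} (hv : 0 < v) (x : EuclideanSpace ℝ (Fin p)) :
    0 ≤ gaussKernel p v x := by
  unfold gaussKernel; positivity

theorem gaussKernel_pos {p : ℕ} {v : ℝ} (hv : 0 < v) (x : EuclideanSpace ℝ (Fin p)) :
    0 < gaussKernel p v x := by
  unfold gaussKernel; positivity

@[fun_prop]
theorem measurable_gaussKernel {α : Type*} [MeasurableSpace α] {p : ℕ} {f : α → ℝ}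
    {g : α → EuclideanSpace ℝ (Fin p)} (hf : Measurable f) (hg : Measurable g) :
    Measurable fun a => gaussKernel p (f a) (g a) := by
  unfold gaussKernel; fun_prop

theorem integral_gaussKernel {p : ℕ} {v : ℝ} (hv : 0 < v) :
    ∫ x, gaussKernel p v x = 1 := by
  have h := GaussianFourier.integral_rexp_neg_mul_sq_norm (V := EuclideanSpace ℝ (Fin p))
    (b := 1 / (2 * v)) (by positivity)
  unfold gaussKernel
  rw [integral_const_mul]
  have e : (fun x : EuclideanSpace ℝ (Fin p) => Real.exp (-‖x‖ ^ 2 / (2 * v)))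
      = fun x => Real.exp (-(1 / (2 * v)) * ‖x‖ ^ 2) := by
    funext x; congr 1; field_simp
  rw [e, h, finrank_euclideanSpace_fin]
  have e2 : Real.pi / (1 / (2 * v)) = 2 * Real.pi * v := by field_simp
  rw [e2, ← Real.rpow_add (by positivity)]
  have : -(p : ℝ) / 2 + p / 2 = 0 := by ring
  rw [this, Real.rpow_zero]

theorem integrable_gaussKernel {p : ℕ} {v : ℝ} (hv : 0 < v) :
    Integrable (gaussKernel p v) := by
  -- A non-integrable function has Bochner integral `0`, against the value `1`.
  by_contra h
  exact zero_ne_one ((integral_undef h).symm.trans (integral_gaussKernel hv))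

theorem lintegral_gaussKernel {p : ℕ} {v : ℝ} (hv : 0 < v) :
    ∫⁻ x, ENNReal.ofReal (gaussKernel p v x) = 1 := by
  rw [← ofReal_integral_eq_lintegral_ofReal (integrable_gaussKernel hv)
    (Filter.Eventually.of_forall (gaussKernel_nonneg hv)), integral_gaussKernel hv,
    ENNReal.ofReal_one]

theorem snDensity_eq_integral (p : ℕ) (F : Measure ℝ) (x : EuclideanSpace ℝ (Fin p)) :
    snDensity p F x = ∫ v, gaussKernel p v x ∂F := rfl

theorem snDensity_eq_toReal {p : ℕ} {F : Measure ℝ} (hF : ∀ᵐ v ∂F, 0 < v)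
    (x : EuclideanSpace ℝ (Fin p)) :
    snDensity p F x = (∫⁻ v, ENNReal.ofReal (gaussKernel p v x) ∂F).toReal := by
  rw [snDensity_eq_integral, integral_eq_lintegral_of_nonneg_ae]
  · filter_upwards [hF] with v hv using gaussKernel_nonneg hv x
  · exact (by fun_prop : Measurable fun v => gaussKernel p v x).aestronglyMeasurable

theorem snDensity_nonneg {p : ℕ} {F : Measure ℝ} (hF : ∀ᵐ v ∂F, 0 < v)
    (x : EuclideanSpace ℝ (Fin p)) : 0 ≤ snDensity p F x := by
  rw [snDensity_eq_toReal hF]; exact ENNReal.toReal_nonneg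

theorem measurable_snDensity {p : ℕ} {F : Measure ℝ} [SFinite F] : Measurable (snDensity p F) := by
  have h : Measurable (Function.uncurry fun (x : EuclideanSpace ℝ (Fin p)) v =>
      gaussKernel p v x) := by
    unfold Function.uncurry; fun_prop
  exact (h.stronglyMeasurable.integral_prod_right (ν := F)).measurable

theorem IsMixing.integrable_gaussKernel {p : ℕ} {F : Measure ℝ} (hF : IsMixing p F)
    (x : EuclideanSpace ℝ (Fin p)) : Integrable (fun v => gaussKernel p v x) F := by
  refine Integrable.mono' (hF.integrable.const_mul ((2 * Real.pi) ^ (-(p : ℝ) / 2)))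
    (by fun_prop : Measurable fun v => gaussKernel p v x).aestronglyMeasurable ?_
  filter_upwards [hF.pos] with v hv
  rw [Real.norm_of_nonneg (gaussKernel_nonneg hv x), gaussKernel,
    Real.mul_rpow (by positivity) hv.le]
  refine mul_le_of_le_one_right (by positivity) (Real.exp_le_one_iff.2 ?_)
  rw [neg_div, neg_nonpos]; positivity

theorem IsMixing.integrable_rpow {p : ℕ} {F : Measure ℝ} (hF : IsMixing p F) {t : ℝ}
    (ht : t ≤ 0) (ht' : -(p : ℝ) / 2 ≤ t) : Integrable (fun v => v ^ t) F := by
  have := hF.isProb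
  refine Integrable.mono' ((integrable_const (1 : ℝ)).add hF.integrable)
    (by fun_prop : Measurable fun v : ℝ => v ^ t).aestronglyMeasurable ?_
  filter_upwards [hF.pos] with v hv
  rw [Real.norm_of_nonneg (by positivity)]
  simp only [Pi.add_apply]
  rcases le_total 1 v with h | h
  · have := Real.rpow_le_one_of_one_le_of_nonpos h ht
    have h2 : 0 ≤ v ^ (-(p : ℝ) / 2) := by positivity
    linarith
  · have := Real.rpow_le_rpow_of_exponent_ge hv h ht'
    linarith

theorem lintegral_gaussKernel_lt_top {p : ℕ} {F : Measure ℝ} (hF : IsMixing p F)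
    (x : EuclideanSpace ℝ (Fin p)) : ∫⁻ v, ENNReal.ofReal (gaussKernel p v x) ∂F < ∞ := by
  have h := (hF.integrable_gaussKernel x).2
  rw [hasFiniteIntegral_iff_ofReal] at h
  · exact h
  · filter_upwards [hF.pos] with v hv using gaussKernel_nonneg hv x

theorem snDensity_pos {p : ℕ} {F : Measure ℝ} (hF : ∀ᵐ v ∂F, 0 < v) (h0 : F ≠ 0)
    {x : EuclideanSpace ℝ (Fin p)} (hx : ∫⁻ v, ENNReal.ofReal (gaussKernel p v x) ∂F < ∞) :
    0 < snDensity p F x := by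
  rw [snDensity_eq_toReal hF, ENNReal.toReal_pos_iff]
  refine ⟨?_, hx⟩
  rw [pos_iff_ne_zero, Ne, lintegral_eq_zero_iff (by fun_prop)]
  intro h
  have : ∀ᵐ v ∂F, False := by
    filter_upwards [hF, h] with v hv h
    have := gaussKernel_pos hv x
    simp only [Pi.zero_apply, ENNReal.ofReal_eq_zero] at h
    linarith
  simp at this
  exact h0 this

/-- Tonelli for weighted scale mixtures of normals. -/
theorem lintegral_lintegral_gaussKernel {p : ℕ} {F : Measure ℝ} [SFinite F]
    {g : EuclideanSpace ℝ (Fin p) → ℝ≥0∞} (hg : Measurable g) (μ : EuclideanSpace ℝ (Fin p)) :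
    ∫⁻ x, (∫⁻ v, ENNReal.ofReal (gaussKernel p v (x - μ)) ∂F) * g x
      = ∫⁻ v, (∫⁻ x, ENNReal.ofReal (gaussKernel p v (x - μ)) * g x) ∂F := by
  rw [lintegral_lintegral_swap]
  · refine lintegral_congr fun x => ?_
    rw [lintegral_mul_const _ (by fun_prop)]
  · unfold Function.uncurry; fun_prop

theorem lintegral_ofReal_snDensity {p : ℕ} {F : Measure ℝ} [SFinite F] (hF : ∀ᵐ v ∂F, 0 < v)
    (h : ∀ᵐ x : EuclideanSpace ℝ (Fin p), ∫⁻ v, ENNReal.ofReal (gaussKernel p v x) ∂F < ∞) :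
    ∫⁻ x, ENNReal.ofReal (snDensity p F x) = F Set.univ := by
  have h1 := lintegral_lintegral_gaussKernel (F := F) (g := fun _ => 1) measurable_const
    (0 : EuclideanSpace ℝ (Fin p))
  simp only [mul_one, sub_zero] at h1
  have h2 : ∫⁻ v, (∫⁻ x : EuclideanSpace ℝ (Fin p), ENNReal.ofReal (gaussKernel p v x)) ∂F
      = ∫⁻ v, 1 ∂F := by
    refine lintegral_congr_ae ?_
    filter_upwards [hF] with v hv using lintegral_gaussKernel hv
  rw [h2, lintegral_one] at h1
  rw [← h1]
  refine lintegral_congr_ae ?_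
  filter_upwards [h] with x hx
  rw [snDensity_eq_toReal hF, ENNReal.ofReal_toReal hx.ne]

theorem integral_snDensity {p : ℕ} {F : Measure ℝ} [SFinite F] (hF : ∀ᵐ v ∂F, 0 < v)
    (h : ∀ᵐ x : EuclideanSpace ℝ (Fin p), ∫⁻ v, ENNReal.ofReal (gaussKernel p v x) ∂F < ∞) :
    ∫ x : EuclideanSpace ℝ (Fin p), snDensity p F x = F.real Set.univ := by
  rw [integral_eq_lintegral_of_nonneg_ae (Filter.Eventually.of_forall (snDensity_nonneg hF))
    measurable_snDensity.aestronglyMeasurable, lintegral_ofReal_snDensity hF h]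
  rfl

/-! ### The `L¹` distance between two translates of a normal law. -/

/-- The density of the centred normal law on `ℝ` with variance `w`. -/
noncomputable def gaussKernelReal (w t : ℝ) : ℝ :=
  (2 * Real.pi * w) ^ (-(1 : ℝ) / 2) * Real.exp (-t ^ 2 / (2 * w))

@[fun_prop]
theorem measurable_gaussKernelReal {α : Type*} [MeasurableSpace α] {f g : α → ℝ}
    (hf : Measurable f) (hg : Measurable g) :
    Measurable fun a => gaussKernelReal (f a) (g a) := by
  unfold gaussKernelReal; fun_prop

theorem continuous_gaussKernelReal (w : ℝ) : Continuous (gaussKernelReal w) := by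
  unfold gaussKernelReal; fun_prop

theorem gaussKernelReal_pos {w : ℝ} (hw : 0 < w) (t : ℝ) : 0 < gaussKernelReal w t := by
  unfold gaussKernelReal; positivity

theorem gaussKernelReal_neg (w t : ℝ) : gaussKernelReal w (-t) = gaussKernelReal w t := by
  simp [gaussKernelReal]

theorem gaussKernelReal_le {w : ℝ} (hw : 0 < w) {s t : ℝ} (h : s ^ 2 ≤ t ^ 2) :
    gaussKernelReal w t ≤ gaussKernelReal w s := by
  unfold gaussKernelReal; gcongr

theorem integral_gaussKernelReal {w : ℝ} (hw : 0 < w) : ∫ t, gaussKernelReal w t = 1 := by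
  unfold gaussKernelReal
  rw [integral_const_mul]
  have e : (fun t : ℝ => Real.exp (-t ^ 2 / (2 * w)))
      = fun t => Real.exp (-(1 / (2 * w)) * t ^ 2) := by
    funext x; congr 1; field_simp
  rw [e, integral_gaussian]
  have e2 : Real.pi / (1 / (2 * w)) = 2 * Real.pi * w := by field_simp
  rw [e2, Real.sqrt_eq_rpow, ← Real.rpow_add (by positivity)]
  norm_num

theorem integrable_gaussKernelReal {w : ℝ} (hw : 0 < w) : Integrable (gaussKernelReal w) := by
  by_contra h
  exact zero_ne_one ((integral_undef h).symm.trans (integral_gaussKernelReal hw))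

/-- The `L¹` distance between the normal laws with variance `w` whose means are `τ` apart. -/
noncomputable def normalL1 (w τ : ℝ) : ℝ := 2 * ∫ t in (0 : ℝ)..τ, gaussKernelReal w (t / 2)

/-- The two densities cross at `τ / 2`. To the left of it the integrand is a plain difference, and
the reflection `t ↦ τ - t` carries the right half line to the left one. -/
theorem integral_abs_gaussKernelReal_sub {w : ℝ} (hw : 0 < w) {τ : ℝ} (hτ : 0 ≤ τ) :
    ∫ t, |gaussKernelReal w t - gaussKernelReal w (t - τ)| = normalL1 w τ := by
  have hf := integrable_gaussKernelReal hw
  have hg : Integrable fun t => gaussKernelReal w (t - τ) := hf.comp_sub_right τ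
  have h1 : ∫ t in Set.Iic (τ / 2), |gaussKernelReal w t - gaussKernelReal w (t - τ)|
      = (∫ t in Set.Iic (τ / 2), gaussKernelReal w t)
        - ∫ t in Set.Iic (-(τ / 2)), gaussKernelReal w t := by
    have : ∫ t in Set.Iic (-(τ / 2)), gaussKernelReal w t
        = ∫ t in Set.Iic (τ / 2), gaussKernelReal w (t - τ) := by
      have mp : MeasurePreserving (fun t : ℝ => t - τ) volume volume :=
        measurePreserving_sub_right volume τ
      rw [← mp.setIntegral_preimage_emb (measurableEmbedding_subRight τ)]
      congr 2
      ext t; simp only [Set.mem_preimage, Set.mem_Iic]; constructor <;> intro h <;> linarith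
    rw [this, ← integral_sub hf.integrableOn hg.integrableOn]
    refine setIntegral_congr_fun measurableSet_Iic fun t ht => ?_
    simp only [Set.mem_Iic] at ht
    exact abs_of_nonneg (sub_nonneg.2 (gaussKernelReal_le hw (by nlinarith)))
  have h2 : ∫ t in (Set.Iic (τ / 2))ᶜ, |gaussKernelReal w t - gaussKernelReal w (t - τ)|
      = (∫ t in Set.Iic (τ / 2), gaussKernelReal w t)
        - ∫ t in Set.Iic (-(τ / 2)), gaussKernelReal w t := by
    have mp : MeasurePreserving (fun t : ℝ => τ - t) volume volume :=
      Measure.measurePreserving_sub_left volume τ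
    rw [← h1, integral_Iic_eq_integral_Iio,
      ← mp.setIntegral_preimage_emb (Homeomorph.subLeft τ).measurableEmbedding
        (fun t => |gaussKernelReal w t - gaussKernelReal w (t - τ)|) (Set.Iio (τ / 2))]
    have : (fun t : ℝ => τ - t) ⁻¹' Set.Iio (τ / 2) = (Set.Iic (τ / 2))ᶜ := by
      ext t; simp only [Set.mem_preimage, Set.mem_Iio, Set.mem_compl_iff, Set.mem_Iic, not_le]
      constructor <;> intro h <;> linarith
    rw [this]
    refine integral_congr_ae (Filter.Eventually.of_forall fun t => ?_)
    have e1 : τ - t - τ = -t := by ring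
    have e2 : τ - t = -(t - τ) := by ring
    simp only [e1]
    rw [e2, gaussKernelReal_neg, gaussKernelReal_neg, abs_sub_comm]
  have h3 : (∫ t in Set.Iic (τ / 2), gaussKernelReal w t)
        - ∫ t in Set.Iic (-(τ / 2)), gaussKernelReal w t
      = ∫ t in (0 : ℝ)..τ, gaussKernelReal w (t / 2) := by
    rw [intervalIntegral.integral_Iic_sub_Iic hf.integrableOn hf.integrableOn,
      intervalIntegral.integral_comp_div _ two_ne_zero, zero_div,
      ← intervalIntegral.integral_add_adjacent_intervals (b := 0)
        (hf.intervalIntegrable) (hf.intervalIntegrable)]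
    have : ∫ t in (-(τ / 2))..0, gaussKernelReal w t
        = ∫ t in (0 : ℝ)..(τ / 2), gaussKernelReal w t := by
      have := intervalIntegral.integral_comp_neg (a := 0) (b := τ / 2) (gaussKernelReal w)
      rw [neg_zero] at this
      rw [← this]; simp only [gaussKernelReal_neg]
    rw [this, smul_eq_mul]; ring
  have hfg : Integrable fun t => |gaussKernelReal w t - gaussKernelReal w (t - τ)| :=
    (hf.sub hg).abs
  rw [← integral_add_compl (measurableSet_Iic (a := τ / 2)) hfg, h1, h2, h3, normalL1]
  ring

theorem gaussKernel_eq_prod {p : ℕ} {w : ℝ} (hw : 0 < w) (x : EuclideanSpace ℝ (Fin p)) :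
    gaussKernel p w x = ∏ i, gaussKernelReal w (x i) := by
  unfold gaussKernel gaussKernelReal
  rw [Finset.prod_mul_distrib, ← Real.exp_sum, Finset.prod_const, Finset.card_univ,
    Fintype.card_fin, ← Real.rpow_mul_natCast (by positivity),
    EuclideanSpace.real_norm_sq_eq, ← Finset.sum_div, Finset.sum_neg_distrib]
  congr 2; ring

theorem gaussKernel_congr_norm {p : ℕ} {w : ℝ} {x y : EuclideanSpace ℝ (Fin p)}
    (h : ‖x‖ = ‖y‖) : gaussKernel p w x = gaussKernel p w y := by
  unfold gaussKernel; rw [h]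

theorem gaussKernel_le {p : ℕ} {w : ℝ} (hw : 0 < w) {x y : EuclideanSpace ℝ (Fin p)}
    (h : ‖x‖ ≤ ‖y‖) : gaussKernel p w y ≤ gaussKernel p w x := by
  unfold gaussKernel; gcongr

/-- A shift along one axis leaves a product of one-dimensional factors, all but the first of which
integrate to `1`. -/
theorem integral_abs_gaussKernel_sub_single {n : ℕ} {w : ℝ} (hw : 0 < w) {τ : ℝ} (hτ : 0 ≤ τ) :
    ∫ x, |gaussKernel (n + 1) w x - gaussKernel (n + 1) w (x - EuclideanSpace.single 0 τ)|
      = normalL1 w τ := by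
  let f : Fin (n + 1) → ℝ → ℝ := Fin.cons
    (fun t => |gaussKernelReal w t - gaussKernelReal w (t - τ)|) fun _ => gaussKernelReal w
  have h : ∀ x : EuclideanSpace ℝ (Fin (n + 1)),
      |gaussKernel (n + 1) w x - gaussKernel (n + 1) w (x - EuclideanSpace.single 0 τ)|
        = ∏ i, f i (x i) := by
    intro x
    rw [gaussKernel_eq_prod hw, gaussKernel_eq_prod hw, Fin.prod_univ_succ, Fin.prod_univ_succ,
      Fin.prod_univ_succ]
    simp only [PiLp.sub_apply, PiLp.single_apply, if_true, f, Fin.cons_zero, Fin.cons_succ,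
      Fin.succ_ne_zero, if_false, sub_zero]
    rw [← sub_mul, abs_mul, abs_of_nonneg (a := ∏ i : Fin n, gaussKernelReal w (x i.succ))
      (Finset.prod_nonneg fun i _ => (gaussKernelReal_pos hw _).le)]
  simp_rw [h]
  have h2 := (EuclideanSpace.volume_preserving_symm_measurableEquiv_toLp (Fin (n + 1))).integral_comp'
    (fun x : Fin (n + 1) → ℝ => ∏ i, f i (x i))
  refine (Eq.trans ?_ h2).trans ?_
  · rfl
  rw [integral_fintype_prod_volume_eq_prod f, Fin.prod_univ_succ]
  simp only [f, Fin.cons_zero, Fin.cons_succ]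
  rw [integral_abs_gaussKernelReal_sub hw hτ, integral_gaussKernelReal hw]
  simp

theorem integral_abs_gaussKernel_sub {p : ℕ} (hp : 0 < p) {w : ℝ} (hw : 0 < w)
    (a b : EuclideanSpace ℝ (Fin p)) :
    ∫ y, |gaussKernel p w (y - a) - gaussKernel p w (y - b)| = normalL1 w ‖a - b‖ := by
  obtain ⟨n, rfl⟩ : ∃ n, p = n + 1 := ⟨p - 1, by omega⟩
  set d := b - a with hd
  have e1 : ‖a - b‖ = ‖d‖ := norm_sub_rev _ _
  set e : EuclideanSpace ℝ (Fin (n + 1)) := EuclideanSpace.single 0 ‖d‖ with he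
  have hde : ‖d‖ = ‖e‖ := by simp [he]
  -- A volume-preserving isometry that turns the shift `d` into one along the first axis.
  let R := (Submodule.span ℝ {d - e})ᗮ.reflection
  have hR : R d = e := Submodule.reflection_sub hde
  have h1 : ∫ y, |gaussKernel (n + 1) w (y - a) - gaussKernel (n + 1) w (y - b)|
      = ∫ y, |gaussKernel (n + 1) w y - gaussKernel (n + 1) w (y - d)| := by
    rw [← integral_add_right_eq_self _ a]
    refine integral_congr_ae (Filter.Eventually.of_forall fun y => ?_)
    have e2 : y + a - b = y - (b - a) := by abel
    simp only [hd, add_sub_cancel_right, e2]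
  rw [h1, e1, ← integral_abs_gaussKernel_sub_single hw (norm_nonneg d), ← he,
    ← (R.measurePreserving).integral_comp R.toHomeomorph.measurableEmbedding
      (fun y => |gaussKernel (n + 1) w y - gaussKernel (n + 1) w (y - e)|)]
  refine integral_congr_ae (Filter.Eventually.of_forall fun y => ?_)
  have h2 : R y - e = R (y - d) := by rw [map_sub, hR]
  simp only
  rw [h2, gaussKernel_congr_norm (R.norm_map y), gaussKernel_congr_norm (R.norm_map (y - d))]

theorem normalL1_nonneg {w : ℝ} (hw : 0 < w) {τ : ℝ} (hτ : 0 ≤ τ) : 0 ≤ normalL1 w τ := by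
  rw [← integral_abs_gaussKernelReal_sub hw hτ]
  exact integral_nonneg fun _ => abs_nonneg _

theorem normalL1_le_two {w : ℝ} (hw : 0 < w) {τ : ℝ} (hτ : 0 ≤ τ) : normalL1 w τ ≤ 2 := by
  have hf := integrable_gaussKernelReal hw
  have hg : Integrable fun t => gaussKernelReal w (t - τ) := hf.comp_sub_right τ
  have e : ∫ t, gaussKernelReal w (t - τ) = 1 := by
    rw [integral_sub_right_eq_self (gaussKernelReal w) τ, integral_gaussKernelReal hw]
  rw [← integral_abs_gaussKernelReal_sub hw hτ]
  calc _ ≤ ∫ t, (gaussKernelReal w t + gaussKernelReal w (t - τ)) := by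
        refine integral_mono (hf.sub hg).abs (hf.add hg) fun t => ?_
        have h1 := gaussKernelReal_pos hw t
        have h2 := gaussKernelReal_pos hw (t - τ)
        simp only
        rw [abs_le]; constructor <;> linarith
    _ = 2 := by rw [integral_add hf hg, integral_gaussKernelReal hw, e]; norm_num

theorem measurable_normalL1 : Measurable (Function.uncurry normalL1) := by
  -- Rescaling to `[0, 1]` moves the variable endpoint into the integrand, so that joint
  -- measurability follows from that of parameter integrals.
  have h : ∀ z : ℝ × ℝ, Function.uncurry normalL1 z
      = 2 * (z.2 * ∫ u in (0 : ℝ)..1, gaussKernelReal z.1 (z.2 * u / 2)) := by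
    rintro ⟨w, τ⟩
    simp only [Function.uncurry, normalL1]
    have := intervalIntegral.smul_integral_comp_mul_left (a := 0) (b := 1)
      (fun t => gaussKernelReal w (t / 2)) τ
    simp only [mul_zero, mul_one, smul_eq_mul] at this
    rw [this]
  have h2 : Measurable fun z : ℝ × ℝ => ∫ u in (0 : ℝ)..1, gaussKernelReal z.1 (z.2 * u / 2) := by
    simp only [intervalIntegral.integral_of_le zero_le_one]
    have : Measurable (Function.uncurry fun (z : ℝ × ℝ) (u : ℝ) =>
        gaussKernelReal z.1 (z.2 * u / 2)) := by
      unfold Function.uncurry; fun_prop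
    exact (this.stronglyMeasurable.integral_prod_right
      (ν := volume.restrict (Set.Ioc (0 : ℝ) 1))).measurable
  rw [show Function.uncurry normalL1 = _ from funext h]
  fun_prop

/-! ### Concavity of the `L¹` distance in the squared distance of the centres. -/

theorem hasDerivAt_normalL1 (w t : ℝ) :
    HasDerivAt (normalL1 w) (2 * gaussKernelReal w (t / 2)) t := by
  have hc : Continuous fun t => gaussKernelReal w (t / 2) :=
    (continuous_gaussKernelReal w).comp (continuous_id.div_const 2)
  exact (hc.integral_hasStrictDerivAt 0 t).hasDerivAt.const_mul 2

/-- `normalL1 w` is a strictly concave function of the squared distance between the means. -/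
theorem normalL1_sub_lt {w : ℝ} (hw : 0 < w) {s t : ℝ} (hs : 0 < s) (ht : 0 ≤ t) (hst : t ≠ s) :
    normalL1 w t - normalL1 w s < gaussKernelReal w (s / 2) / s * (t ^ 2 - s ^ 2) := by
  set c := gaussKernelReal w (s / 2) / s with hc
  have hcs : gaussKernelReal w (s / 2) = c * s := by rw [hc]; field_simp
  have hc0 : 0 < c := div_pos (gaussKernelReal_pos hw _) hs
  have hD : ∀ u, HasDerivAt (fun u => normalL1 w u - c * u ^ 2)
      (2 * gaussKernelReal w (u / 2) - c * (2 * u)) u := by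
    intro u
    have := (hasDerivAt_normalL1 w u).sub ((hasDerivAt_pow 2 u).const_mul c)
    exact this.congr_deriv (by simp)
  have hcont : Continuous fun u => normalL1 w u - c * u ^ 2 :=
    continuous_iff_continuousAt.2 fun u => (hD u).continuousAt
  -- After subtraction of the tangent in `u²`, the derivative is twice `φ_w(u/2) - c u`. The first
  -- term decreases for `u ≥ 0`, the second increases, and they agree at `s`, so `s` is the strict
  -- maximum.
  suffices h : normalL1 w t - c * t ^ 2 < normalL1 w s - c * s ^ 2 by linarith
  rcases lt_or_gt_of_ne hst with h | h
  · refine strictMonoOn_of_deriv_pos (convex_Icc 0 s) hcont.continuousOn ?_ ⟨ht, h.le⟩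
      ⟨hs.le, le_rfl⟩ h
    intro u hu
    rw [interior_Icc] at hu
    rw [(hD u).deriv]
    have h1 : gaussKernelReal w (s / 2) ≤ gaussKernelReal w (u / 2) :=
      gaussKernelReal_le hw (by nlinarith [hu.1, hu.2])
    have h2 := mul_lt_mul_of_pos_left hu.2 hc0
    linarith
  · refine strictAntiOn_of_deriv_neg (convex_Ici s) hcont.continuousOn ?_ Set.self_mem_Ici
      (Set.mem_Ici.2 h.le) h
    intro u hu
    rw [interior_Ici] at hu
    have hu' : s < u := hu
    rw [(hD u).deriv]
    have h1 : gaussKernelReal w (u / 2) ≤ gaussKernelReal w (s / 2) :=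
      gaussKernelReal_le hw (by nlinarith)
    have h2 := mul_lt_mul_of_pos_left hu' hc0
    linarith

/-! ### Passage to scale mixtures. -/

/-- The `L¹` distance between two translates, `τ` apart, of the scale mixture of normals with
mixing law `H`. -/
noncomputable def mixtureL1 (H : Measure ℝ) (τ : ℝ) : ℝ := ∫ w, normalL1 w τ ∂H

/-- The derivative of `mixtureL1 H` with respect to the squared distance, at distance `s`. -/
noncomputable def mixtureSlope (H : Measure ℝ) (s : ℝ) : ℝ :=
  (∫ w, gaussKernelReal w (s / 2) ∂H) / s

/-- The sign of the kernel difference depends on which of `‖x‖`, `‖y‖` is larger and not on `w`, so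
the absolute value passes through the mixture with equality. -/
theorem ofReal_abs_snDensity_sub {p : ℕ} {H : Measure ℝ} (hH : IsMixing p H)
    (x y : EuclideanSpace ℝ (Fin p)) :
    ENNReal.ofReal |snDensity p H x - snDensity p H y|
      = ∫⁻ w, ENNReal.ofReal |gaussKernel p w x - gaussKernel p w y| ∂H := by
  have key : ∀ x y : EuclideanSpace ℝ (Fin p), ‖x‖ ≤ ‖y‖ →
      ENNReal.ofReal |snDensity p H x - snDensity p H y|
        = ∫⁻ w, ENNReal.ofReal |gaussKernel p w x - gaussKernel p w y| ∂H := by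
    intro x y h
    have hx := hH.integrable_gaussKernel x
    have hy := hH.integrable_gaussKernel y
    have hxy : Integrable (fun w => gaussKernel p w x - gaussKernel p w y) H := hx.sub hy
    have hle : ∀ᵐ w ∂H, 0 ≤ gaussKernel p w x - gaussKernel p w y := by
      filter_upwards [hH.pos] with w hw
      exact sub_nonneg.2 (gaussKernel_le hw h)
    rw [snDensity_eq_integral, snDensity_eq_integral, ← integral_sub hx hy,
      abs_of_nonneg (integral_nonneg_of_ae hle),
      ofReal_integral_eq_lintegral_ofReal hxy hle]
    refine lintegral_congr_ae ?_
    filter_upwards [hle] with w hw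
    rw [abs_of_nonneg hw]
  rcases le_total ‖x‖ ‖y‖ with h | h
  · exact key x y h
  · rw [abs_sub_comm, key y x h]
    simp only [abs_sub_comm]

theorem measurable_normalL1_comp {α : Type*} [MeasurableSpace α] {f g : α → ℝ}
    (hf : Measurable f) (hg : Measurable g) : Measurable fun a => normalL1 (f a) (g a) :=
  measurable_normalL1.comp (hf.prodMk hg)

theorem measurable_mixtureL1 (H : Measure ℝ) [SFinite H] : Measurable (mixtureL1 H) := by
  have h : Measurable (Function.uncurry fun (τ w : ℝ) => normalL1 w τ) :=
    measurable_normalL1_comp measurable_snd measurable_fst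
  exact (h.stronglyMeasurable.integral_prod_right (ν := H)).measurable

theorem integrable_normalL1 {H : Measure ℝ} [IsProbabilityMeasure H] (hH : ∀ᵐ w ∂H, 0 < w)
    {τ : ℝ} (hτ : 0 ≤ τ) : Integrable (fun w => normalL1 w τ) H := by
  refine Integrable.mono' (integrable_const (2 : ℝ))
    (measurable_normalL1_comp measurable_id measurable_const).aestronglyMeasurable ?_
  filter_upwards [hH] with w hw
  rw [Real.norm_of_nonneg (normalL1_nonneg hw hτ)]
  exact normalL1_le_two hw hτ

theorem mixtureL1_nonneg {H : Measure ℝ} (hH : ∀ᵐ w ∂H, 0 < w) {τ : ℝ} (hτ : 0 ≤ τ) :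
    0 ≤ mixtureL1 H τ := by
  refine integral_nonneg_of_ae ?_
  filter_upwards [hH] with w hw using normalL1_nonneg hw hτ

theorem mixtureL1_le_two {H : Measure ℝ} [IsProbabilityMeasure H] (hH : ∀ᵐ w ∂H, 0 < w)
    {τ : ℝ} (hτ : 0 ≤ τ) : mixtureL1 H τ ≤ 2 := by
  calc mixtureL1 H τ ≤ ∫ _, (2 : ℝ) ∂H := by
        refine integral_mono_ae (integrable_normalL1 hH hτ) (integrable_const _) ?_
        filter_upwards [hH] with w hw using normalL1_le_two hw hτ
    _ = 2 := by simp

theorem lintegral_abs_snDensity_sub {p : ℕ} (hp : 0 < p) {H : Measure ℝ} (hH : IsMixing p H)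
    (a b : EuclideanSpace ℝ (Fin p)) :
    ∫⁻ y, ENNReal.ofReal |snDensity p H (y - a) - snDensity p H (y - b)|
      = ENNReal.ofReal (mixtureL1 H ‖a - b‖) := by
  have := hH.isProb
  simp_rw [ofReal_abs_snDensity_sub hH]
  rw [lintegral_lintegral_swap, mixtureL1, ofReal_integral_eq_lintegral_ofReal
    (integrable_normalL1 hH.pos (norm_nonneg _))]
  · refine lintegral_congr_ae ?_
    filter_upwards [hH.pos] with w hw
    rw [← integral_abs_gaussKernel_sub hp hw, ofReal_integral_eq_lintegral_ofReal]
    · exact (((integrable_gaussKernel hw).comp_sub_right a).sub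
        ((integrable_gaussKernel hw).comp_sub_right b)).abs
    · exact Filter.Eventually.of_forall fun _ => abs_nonneg _
  · filter_upwards [hH.pos] with w hw using normalL1_nonneg hw (norm_nonneg _)
  · have : Measurable (Function.uncurry fun (y : EuclideanSpace ℝ (Fin p)) w =>
        ENNReal.ofReal |gaussKernel p w (y - a) - gaussKernel p w (y - b)|) := by
      unfold Function.uncurry
      have h : Measurable fun z : EuclideanSpace ℝ (Fin p) × ℝ =>
        gaussKernel p z.2 (z.1 - a) - gaussKernel p z.2 (z.1 - b) := by fun_prop
      exact ENNReal.measurable_ofReal.comp h.abs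
    exact this.aemeasurable

theorem integrable_gaussKernelReal_mixing {p : ℕ} (hp : 0 < p) {H : Measure ℝ}
    (hH : IsMixing p H) (t : ℝ) : Integrable (fun w => gaussKernelReal w t) H := by
  have hp' : (1 : ℝ) ≤ p := by exact_mod_cast hp
  refine Integrable.mono' ((hH.integrable_rpow (t := -(1 : ℝ) / 2) (by norm_num)
    (by linarith)).const_mul ((2 * Real.pi) ^ (-(1 : ℝ) / 2)))
    (by fun_prop : Measurable fun w => gaussKernelReal w t).aestronglyMeasurable ?_
  filter_upwards [hH.pos] with w hw
  rw [Real.norm_of_nonneg (gaussKernelReal_pos hw t).le, gaussKernelReal,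
    Real.mul_rpow (by positivity) hw.le]
  refine mul_le_of_le_one_right (by positivity) (Real.exp_le_one_iff.2 ?_)
  rw [neg_div, neg_nonpos]; positivity

theorem mixtureL1_sub_lt {p : ℕ} (hp : 0 < p) {H : Measure ℝ} (hH : IsMixing p H) {s t : ℝ}
    (hs : 0 < s) (ht : 0 ≤ t) (hst : t ≠ s) :
    mixtureL1 H t - mixtureL1 H s < mixtureSlope H s * (t ^ 2 - s ^ 2) := by
  have := hH.isProb
  have ht' := integrable_normalL1 hH.pos ht
  have hs' := integrable_normalL1 hH.pos hs.le
  have hts : Integrable (fun w => normalL1 w t - normalL1 w s) H := ht'.sub hs'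
  have hg := ((integrable_gaussKernelReal_mixing hp hH (s / 2)).div_const s).mul_const
    (t ^ 2 - s ^ 2)
  have e : mixtureSlope H s * (t ^ 2 - s ^ 2)
      = ∫ w, gaussKernelReal w (s / 2) / s * (t ^ 2 - s ^ 2) ∂H := by
    rw [integral_mul_const, integral_div, mixtureSlope]
  rw [e, mixtureL1, mixtureL1, ← integral_sub ht' hs', ← sub_pos,
    ← integral_sub hg hts]
  have hpos : ∀ᵐ w ∂H, 0 < gaussKernelReal w (s / 2) / s * (t ^ 2 - s ^ 2)
      - (normalL1 w t - normalL1 w s) := by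
    filter_upwards [hH.pos] with w hw
    exact sub_pos.2 (normalL1_sub_lt hw hs ht hst)
  rw [integral_pos_iff_support_of_nonneg_ae]
  · rw [pos_iff_ne_zero]
    intro h0
    have : ∀ᵐ w ∂H, False := by
      filter_upwards [hpos, measure_eq_zero_iff_ae_notMem.1 h0] with w h1 h2
      exact h2 h1.ne'
    simp only [Filter.eventually_false_iff_eq_bot, ae_eq_bot] at this
    exact IsProbabilityMeasure.ne_zero H this
  · filter_upwards [hpos] with w hw using hw.le
  · exact hg.sub hts

theorem mixtureL1_sub_le {p : ℕ} (hp : 0 < p) {H : Measure ℝ} (hH : IsMixing p H) {s t : ℝ}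
    (hs : 0 < s) (ht : 0 ≤ t) :
    mixtureL1 H t - mixtureL1 H s ≤ mixtureSlope H s * (t ^ 2 - s ^ 2) := by
  rcases eq_or_ne t s with rfl | h
  · simp
  · exact (mixtureL1_sub_lt hp hH hs ht h).le

/-! ### The law of `Z`. -/

theorem measurable_tauWeight (p : ℕ) : Measurable (tauWeight p) := by
  unfold tauWeight; fun_prop

theorem ae_prod_pos {G H : Measure ℝ} [SFinite G] [SFinite H] (hG : ∀ᵐ v ∂G, 0 < v)
    (hH : ∀ᵐ w ∂H, 0 < w) : ∀ᵐ z ∂(G.prod H), 0 < z.1 ∧ 0 < z.2 :=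
  (Measure.quasiMeasurePreserving_fst.ae hG).and (Measure.quasiMeasurePreserving_snd.ae hH)

theorem lintegral_tauWeight_ne_zero {p : ℕ} {G H : Measure ℝ} (hG : IsMixing p G)
    (hH : IsMixing p H) : ∫⁻ z, tauWeight p z ∂(G.prod H) ≠ 0 := by
  have := hG.isProb
  have := hH.isProb
  rw [Ne, lintegral_eq_zero_iff (measurable_tauWeight p)]
  intro h
  have : ∀ᵐ z ∂(G.prod H), False := by
    filter_upwards [h, ae_prod_pos hG.pos hH.pos] with z h1 ⟨h2, h3⟩
    simp only [tauWeight, Pi.zero_apply, ENNReal.ofReal_eq_zero] at h1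
    have : 0 < z.2 ^ (((p : ℝ) - 1) / 2) / (z.1 + 4 * z.2) ^ ((p : ℝ) / 2) := by positivity
    linarith
  simp only [Filter.eventually_false_iff_eq_bot, ae_eq_bot] at this
  exact IsProbabilityMeasure.ne_zero _ this

/-- Since `z₂ ≤ z₁ + 4 z₂`, the weight is at most `(z₁ + 4 z₂)^(-1/2) ≤ z₁^(-1/2)`. -/
theorem lintegral_tauWeight_ne_top {p : ℕ} (hp : 0 < p) {G H : Measure ℝ} (hG : IsMixing p G)
    (hH : IsMixing p H) : ∫⁻ z, tauWeight p z ∂(G.prod H) ≠ ∞ := by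
  have := hG.isProb
  have := hH.isProb
  have hp' : (1 : ℝ) ≤ p := by exact_mod_cast hp
  have hi : Integrable (fun z : ℝ × ℝ => z.1 ^ (-(1 : ℝ) / 2)) (G.prod H) :=
    (hG.integrable_rpow (t := -(1 : ℝ) / 2) (by norm_num) (by linarith)).comp_fst H
  have h2 := hi.2
  rw [hasFiniteIntegral_iff_ofReal] at h2
  · refine ((lintegral_mono_ae ?_).trans_lt h2).ne
    filter_upwards [ae_prod_pos hG.pos hH.pos] with z ⟨h1, h2⟩
    refine ENNReal.ofReal_le_ofReal ?_
    calc _ ≤ (z.1 + 4 * z.2) ^ (((p : ℝ) - 1) / 2) / (z.1 + 4 * z.2) ^ ((p : ℝ) / 2) := by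
          gcongr
          linarith
      _ = (z.1 + 4 * z.2) ^ (-(1 : ℝ) / 2) := by
          rw [← Real.rpow_sub (by positivity)]; congr 1; ring
      _ ≤ _ := Real.rpow_le_rpow_of_nonpos h1 (by linarith) (by norm_num)
  · filter_upwards [ae_prod_pos hG.pos hH.pos] with z ⟨h1, h2⟩
    positivity

theorem lintegral_lawZ {p : ℕ} {G H : Measure ℝ} [SFinite G] [SFinite H] {f : ℝ → ℝ≥0∞}
    (hf : Measurable f) :
    ∫⁻ z, f z ∂(lawZ p G H) = (∫⁻ z, tauWeight p z ∂(G.prod H))⁻¹ *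
      ∫⁻ z, tauWeight p z * f (4 * z.1 * z.2 / (z.1 + 4 * z.2)) ∂(G.prod H) := by
  have h := lintegral_withDensity_eq_lintegral_mul (G.prod H) (measurable_tauWeight p)
    (hf.comp (by fun_prop : Measurable fun z : ℝ × ℝ => 4 * z.1 * z.2 / (z.1 + 4 * z.2)))
  simp only [Function.comp_apply, Pi.mul_apply] at h
  rw [lawZ, lintegral_map hf (by fun_prop), tau, lintegral_smul_measure, h, smul_eq_mul]

theorem isProbabilityMeasure_lawZ {p : ℕ} (hp : 0 < p) {G H : Measure ℝ} (hG : IsMixing p G)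
    (hH : IsMixing p H) : IsProbabilityMeasure (lawZ p G H) := by
  have := hG.isProb
  have := hH.isProb
  constructor
  rw [← lintegral_one, lintegral_lawZ measurable_const]
  simp only [mul_one]
  exact ENNReal.inv_mul_cancel (lintegral_tauWeight_ne_zero hG hH)
    (lintegral_tauWeight_ne_top hp hG hH)

theorem lawZ_pos {p : ℕ} {G H : Measure ℝ} (hG : IsMixing p G) (hH : IsMixing p H) :
    ∀ᵐ z ∂(lawZ p G H), 0 < z := by
  have := hG.isProb
  have := hH.isProb
  rw [lawZ, ae_map_iff (by fun_prop) measurableSet_Ioi, tau]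
  refine Measure.ae_smul_measure ?_ _
  refine (withDensity_absolutelyContinuous _ _).ae_le ?_
  filter_upwards [ae_prod_pos hG.pos hH.pos] with z ⟨h1, h2⟩
  positivity

theorem isMixing_lawZ {p : ℕ} (hp : 0 < p) {G H : Measure ℝ} (hG : IsMixing p G)
    (hH : IsMixing p H) : IsMixing p (lawZ p G H) := by
  have := hG.isProb
  have := hH.isProb
  have hp' : (1 : ℝ) ≤ p := by exact_mod_cast hp
  refine ⟨isProbabilityMeasure_lawZ hp hG hH, lawZ_pos hG hH, ?_⟩
  have hm : Measurable fun v : ℝ => v ^ (-(p : ℝ) / 2) := by fun_prop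
  refine ⟨hm.aestronglyMeasurable, ?_⟩
  rw [hasFiniteIntegral_iff_ofReal]
  · rw [lintegral_lawZ (by fun_prop)]
    refine ENNReal.mul_lt_top
      (ENNReal.inv_lt_top.2 (pos_iff_ne_zero.2 (lintegral_tauWeight_ne_zero hG hH))) ?_
    -- The weight of `τ` times `Z^(-p/2)` is exactly this product, whose two factors are integrable
    -- under `G` and `H`.
    have hi : Integrable (fun z : ℝ × ℝ => (4 : ℝ) ^ (-(p : ℝ) / 2) *
        (z.1 ^ (-(p : ℝ) / 2) * z.2 ^ (-(1 : ℝ) / 2))) (G.prod H) :=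
      (hG.integrable.mul_prod (hH.integrable_rpow (t := -(1 : ℝ) / 2) (by norm_num)
        (by linarith))).const_mul _
    have h2 := hi.2
    rw [hasFiniteIntegral_iff_ofReal] at h2
    · refine lt_of_eq_of_lt (lintegral_congr_ae ?_) h2
      filter_upwards [ae_prod_pos hG.pos hH.pos] with z ⟨h1, h2⟩
      have h3 : 0 < z.1 + 4 * z.2 := by positivity
      rw [tauWeight, ← ENNReal.ofReal_mul (by positivity)]
      congr 1
      rw [Real.div_rpow (by positivity) h3.le, Real.mul_rpow (by positivity) h2.le,
        Real.mul_rpow (by positivity) h1.le, neg_div, Real.rpow_neg h3.le]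
      have e : z.2 ^ (((p : ℝ) - 1) / 2) * z.2 ^ (-((p : ℝ) / 2)) = z.2 ^ (-(1 : ℝ) / 2) := by
        rw [← Real.rpow_add h2]; congr 1; ring
      rw [← e]
      field_simp
    · filter_upwards [ae_prod_pos hG.pos hH.pos] with z ⟨h1, h2⟩
      positivity
  · filter_upwards [lawZ_pos hG hH] with v hv
    positivity

/-- The slope of the `L¹` loss against the density of `X` is proportional to
`‖s‖⁻¹ snDensity (lawZ)`. -/
theorem exists_mixtureSlope_mul_snDensity {p : ℕ} (hp : 0 < p) {G H : Measure ℝ}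
    (hG : IsMixing p G) (hH : IsMixing p H) :
    ∃ K : ℝ, 0 < K ∧ ∀ s : EuclideanSpace ℝ (Fin p),
      mixtureSlope H ‖s‖ * snDensity p G s = K * (snDensity p (lawZ p G H) s / ‖s‖) := by
  have := hG.isProb
  have := hH.isProb
  set T := ∫⁻ z, tauWeight p z ∂(G.prod H) with hT
  have hT0 := lintegral_tauWeight_ne_zero hG hH
  have hT1 := lintegral_tauWeight_ne_top hp hG hH
  have hTpos : 0 < T.toReal := ENNReal.toReal_pos hT0 hT1
  set C : ℝ := (4 : ℝ) ^ (-(p : ℝ) / 2) * (2 * Real.pi) ^ ((1 : ℝ) / 2) with hC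
  have hCpos : 0 < C := by positivity
  -- The origin needs no exception: there both sides are `0` through division by `‖s‖ = 0`.
  refine ⟨T.toReal / C, by positivity, fun s => ?_⟩
  have key : snDensity p (lawZ p G H) s
      = T.toReal⁻¹ * (C * (snDensity p G s * ∫ w, gaussKernelReal w (‖s‖ / 2) ∂H)) := by
    have e1 : ∫ w, gaussKernelReal w (‖s‖ / 2) ∂H
        = (∫⁻ w, ENNReal.ofReal (gaussKernelReal w (‖s‖ / 2)) ∂H).toReal := by
      rw [integral_eq_lintegral_of_nonneg_ae]
      · filter_upwards [hH.pos] with w hw using (gaussKernelReal_pos hw _).le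
      · exact (by fun_prop : Measurable fun w =>
          gaussKernelReal w (‖s‖ / 2)).aestronglyMeasurable
    rw [snDensity_eq_toReal (lawZ_pos hG hH), snDensity_eq_toReal hG.pos, e1,
      lintegral_lawZ (by fun_prop), ENNReal.toReal_mul, ENNReal.toReal_inv, ← ENNReal.toReal_mul,
      ← lintegral_prod_mul (by fun_prop) (by fun_prop),
      ← ENNReal.toReal_ofReal hCpos.le, ← ENNReal.toReal_mul,
      ← lintegral_const_mul _ (by fun_prop)]
    congr 2
    refine lintegral_congr_ae ?_
    filter_upwards [ae_prod_pos hG.pos hH.pos] with z ⟨h1, h2⟩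
    have h3 : 0 < z.1 + 4 * z.2 := by positivity
    rw [tauWeight, ← ENNReal.ofReal_mul (by positivity),
      ← ENNReal.ofReal_mul (gaussKernel_nonneg h1 _), ← ENNReal.ofReal_mul (by positivity)]
    congr 1
    -- This is `1/Z = 1/z₁ + 1/(4 z₂)`, the origin of the formula for `Z`.
    have e2 : Real.exp (-‖s‖ ^ 2 / (2 * (4 * z.1 * z.2 / (z.1 + 4 * z.2))))
        = Real.exp (-‖s‖ ^ 2 / (2 * z.1)) * Real.exp (-(‖s‖ / 2) ^ 2 / (2 * z.2)) := by
      rw [← Real.exp_add]; congr 1; field_simp; ring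
    have e3 : (2 * Real.pi * (4 * z.1 * z.2 / (z.1 + 4 * z.2))) ^ (-(p : ℝ) / 2)
        = (2 * Real.pi * z.1) ^ (-(p : ℝ) / 2) * (4 : ℝ) ^ (-(p : ℝ) / 2)
          * z.2 ^ (-(p : ℝ) / 2) * (z.1 + 4 * z.2) ^ ((p : ℝ) / 2) := by
      rw [show 2 * Real.pi * (4 * z.1 * z.2 / (z.1 + 4 * z.2))
        = (2 * Real.pi * z.1) * 4 * z.2 / (z.1 + 4 * z.2) by ring,
        Real.div_rpow (by positivity) h3.le, Real.mul_rpow (by positivity) h2.le,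
        Real.mul_rpow (by positivity) (by norm_num), neg_div, Real.rpow_neg h3.le, div_inv_eq_mul]
    have e4 : (2 * Real.pi * z.2) ^ (-(1 : ℝ) / 2)
        = (2 * Real.pi) ^ (-(1 : ℝ) / 2) *
          (z.2 ^ (((p : ℝ) - 1) / 2) * z.2 ^ (-(p : ℝ) / 2)) := by
      rw [Real.mul_rpow (by positivity) h2.le, ← Real.rpow_add h2]
      congr 2; ring
    have e5 : (2 * Real.pi) ^ ((1 : ℝ) / 2) * (2 * Real.pi) ^ (-(1 : ℝ) / 2) = 1 := by
      rw [← Real.rpow_add (by positivity)]; norm_num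
    have e6 : (z.1 + 4 * z.2) ^ ((p : ℝ) / 2) ≠ 0 := by positivity
    rw [gaussKernel, gaussKernel, gaussKernelReal, e2, e3, e4, hC]
    trans (4 : ℝ) ^ (-(p : ℝ) / 2) * ((2 * Real.pi * z.1) ^ (-(p : ℝ) / 2) *
          Real.exp (-‖s‖ ^ 2 / (2 * z.1)) * (z.2 ^ (((p : ℝ) - 1) / 2)
          * z.2 ^ (-(p : ℝ) / 2) * Real.exp (-(‖s‖ / 2) ^ 2 / (2 * z.2))))
    · field_simp
    · linear_combination -((4 : ℝ) ^ (-(p : ℝ) / 2) * ((2 * Real.pi * z.1) ^ (-(p : ℝ) / 2) *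
          Real.exp (-‖s‖ ^ 2 / (2 * z.1)) * (z.2 ^ (((p : ℝ) - 1) / 2)
          * z.2 ^ (-(p : ℝ) / 2) * Real.exp (-(‖s‖ / 2) ^ 2 / (2 * z.2))))) * e5
  rw [key, mixtureSlope]
  field_simp

/-! ### Dividing a scale mixture of normals by the norm; beta integrals and moments. -/

/-- The integrand of a beta integral, on `(0, ∞)`. -/
noncomputable def betaKernel (q κ : ℝ) : ℝ := κ ^ (-(1 : ℝ) / 2) * (1 + κ) ^ (-q)

@[fun_prop]
theorem measurable_betaKernel (q : ℝ) : Measurable (betaKernel q) := by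
  unfold betaKernel; fun_prop

theorem betaKernel_pos (q : ℝ) {κ : ℝ} (hκ : 0 < κ) : 0 < betaKernel q κ := by
  unfold betaKernel; positivity

theorem integrableOn_betaKernel {q : ℝ} (hq : 1 ≤ q) :
    IntegrableOn (betaKernel q) (Set.Ioi 0) := by
  rw [← Set.Ioc_union_Ioi_eq_Ioi (zero_le_one (α := ℝ))]
  refine IntegrableOn.union ?_ ?_
  · have h : IntegrableOn (fun κ : ℝ => κ ^ (-(1 : ℝ) / 2)) (Set.Ioc 0 1) :=
      (intervalIntegrable_iff_integrableOn_Ioc_of_le zero_le_one).1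
        (intervalIntegral.intervalIntegrable_rpow' (by norm_num))
    refine Integrable.mono' h (measurable_betaKernel q).aestronglyMeasurable ?_
    filter_upwards [ae_restrict_mem measurableSet_Ioc] with κ hκ
    rw [Real.norm_of_nonneg (betaKernel_pos q hκ.1).le, betaKernel]
    refine mul_le_of_le_one_right (Real.rpow_nonneg hκ.1.le _) ?_
    exact Real.rpow_le_one_of_one_le_of_nonpos (by linarith [hκ.1]) (by linarith)
  · have h : IntegrableOn (fun κ : ℝ => κ ^ (-(3 : ℝ) / 2)) (Set.Ioi 1) :=
      integrableOn_Ioi_rpow_of_lt (by norm_num) one_pos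
    refine Integrable.mono' h (measurable_betaKernel q).aestronglyMeasurable ?_
    filter_upwards [ae_restrict_mem measurableSet_Ioi] with κ hκ
    have h1 : (1 : ℝ) < κ := hκ
    have h0 : 0 < κ := by linarith
    rw [Real.norm_of_nonneg (betaKernel_pos q h0).le, betaKernel]
    calc _ ≤ κ ^ (-(1 : ℝ) / 2) * κ ^ (-(1 : ℝ)) := by
          gcongr
          calc (1 + κ) ^ (-q) ≤ (1 + κ) ^ (-(1 : ℝ)) :=
                Real.rpow_le_rpow_of_exponent_le (by linarith) (by linarith)
            _ ≤ _ := Real.rpow_le_rpow_of_nonpos h0 (by linarith) (by norm_num)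
      _ = _ := by rw [← Real.rpow_add h0]; norm_num

theorem integral_betaKernel_pos {q : ℝ} (hq : 1 ≤ q) :
    0 < ∫ κ in Set.Ioi 0, betaKernel q κ := by
  rw [setIntegral_pos_iff_support_of_nonneg_ae _ (integrableOn_betaKernel hq)]
  · refine lt_of_lt_of_le ?_ (measure_mono (s := Set.Ioo 0 1) ?_)
    · simp
    · intro κ hκ
      exact ⟨(betaKernel_pos q hκ.1).ne', hκ.1⟩
  · filter_upwards [ae_restrict_mem measurableSet_Ioi] with κ hκ using (betaKernel_pos q hκ).le

/-- The function `κ^(1/2) (1+κ)^(-q)` vanishes at `0` and at infinity, so its derivative integrates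
to zero. This recursion is the source of the factor `(p-2)/(p-3)`. -/
theorem integral_betaKernel_succ {q : ℝ} (hq : 1 ≤ q) :
    (q - 1 / 2) * ∫ κ in Set.Ioi 0, betaKernel q κ
      = q * ∫ κ in Set.Ioi 0, betaKernel (q + 1) κ := by
  have hi := integrableOn_betaKernel hq
  have hi' := integrableOn_betaKernel (q := q + 1) (by linarith)
  have h := integral_Ioi_of_hasDerivAt_of_tendsto (a := 0) (m := 0)
    (f := fun κ : ℝ => κ ^ ((1 : ℝ) / 2) * (1 + κ) ^ (-q))
    (f' := fun κ => q * betaKernel (q + 1) κ - (q - 1 / 2) * betaKernel q κ) ?_ ?_ ?_ ?_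
  · rw [integral_sub (hi'.const_mul _) (hi.const_mul _), integral_const_mul,
      integral_const_mul] at h
    norm_num at h
    linarith
  · refine ContinuousAt.continuousWithinAt (ContinuousAt.mul ?_ ?_)
    · exact Real.continuousAt_rpow_const _ _ (Or.inr (by norm_num))
    · exact ContinuousAt.rpow_const (by fun_prop) (Or.inl (by norm_num))
  · intro κ hκ
    have hκ' : (0 : ℝ) < κ := hκ
    have h1 := Real.hasDerivAt_rpow_const (x := κ) (p := (1 : ℝ) / 2) (Or.inl hκ'.ne')
    have h2 := ((hasDerivAt_id κ).const_add 1).rpow_const (p := -q) (Or.inl (by simp; positivity))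
    refine (h1.mul h2).congr_deriv ?_
    simp only [betaKernel, id]
    have e1 : κ ^ ((1 : ℝ) / 2) = κ * κ ^ (-(1 : ℝ) / 2) := by
      nth_rewrite 2 [← Real.rpow_one κ]
      rw [← Real.rpow_add hκ']; norm_num
    have e2 : (1 + κ) ^ (-q) = (1 + κ) * (1 + κ) ^ (-(q + 1)) := by
      nth_rewrite 2 [← Real.rpow_one (1 + κ)]
      rw [← Real.rpow_add (by positivity)]; congr 1; ring
    have e3 : (1 : ℝ) / 2 - 1 = -1 / 2 := by norm_num
    have e4 : -q - 1 = -(q + 1) := by ring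
    rw [e3, e4, e1, e2]; ring
  · exact (hi'.const_mul _).sub (hi.const_mul _)
  · have h0 : Filter.Tendsto (fun κ : ℝ => κ ^ (-(q - 1 / 2))) Filter.atTop (nhds 0) :=
      tendsto_rpow_neg_atTop (by linarith)
    refine squeeze_zero' ?_ ?_ h0
    · filter_upwards [Filter.eventually_gt_atTop 0] with κ hκ
      positivity
    · filter_upwards [Filter.eventually_gt_atTop 0] with κ hκ
      calc _ ≤ κ ^ ((1 : ℝ) / 2) * κ ^ (-q) := by
            refine mul_le_mul_of_nonneg_left ?_ (by positivity)
            exact Real.rpow_le_rpow_of_nonpos hκ (by linarith) (by linarith)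
        _ = _ := by rw [← Real.rpow_add hκ]; congr 1; ring

/-- The (unnormalized) mixing measure of `s ↦ ‖s‖⁻¹ snDensity p F s`. -/
noncomputable def divNormMixing (p : ℕ) (F : Measure ℝ) : Measure ℝ :=
  ((F.prod (volume.restrict (Set.Ioi 0))).withDensity fun z =>
    ENNReal.ofReal (z.1 ^ (-(1 : ℝ) / 2) * betaKernel ((p : ℝ) / 2) z.2)).map
      fun z => z.1 / (1 + z.2)

theorem ae_prod_Ioi_pos {F : Measure ℝ} [SFinite F] (hF : ∀ᵐ v ∂F, 0 < v) :
    ∀ᵐ z ∂(F.prod (volume.restrict (Set.Ioi (0 : ℝ)))), 0 < z.1 ∧ 0 < z.2 :=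
  ae_prod_pos hF (ae_restrict_mem measurableSet_Ioi)

theorem divNormMixing_pos {p : ℕ} {F : Measure ℝ} [SFinite F] (hF : ∀ᵐ v ∂F, 0 < v) :
    ∀ᵐ v ∂(divNormMixing p F), 0 < v := by
  rw [divNormMixing, ae_map_iff (by fun_prop) measurableSet_Ioi]
  refine (withDensity_absolutelyContinuous _ _).ae_le ?_
  filter_upwards [ae_prod_Ioi_pos hF] with z ⟨h1, h2⟩
  positivity

theorem lintegral_divNormMixing {p : ℕ} {F : Measure ℝ} [SFinite F] (hF : ∀ᵐ v ∂F, 0 < v)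
    {f : ℝ → ℝ} (hf : Measurable f) :
    ∫⁻ v, ENNReal.ofReal (f v) ∂(divNormMixing p F)
      = ∫⁻ z, ENNReal.ofReal (z.1 ^ (-(1 : ℝ) / 2) * betaKernel ((p : ℝ) / 2) z.2
          * f (z.1 / (1 + z.2))) ∂(F.prod (volume.restrict (Set.Ioi 0))) := by
  have hm : Measurable fun z : ℝ × ℝ => z.1 / (1 + z.2) := by fun_prop
  have h := lintegral_withDensity_eq_lintegral_mul (F.prod (volume.restrict (Set.Ioi (0 : ℝ))))
    (f := fun z => ENNReal.ofReal (z.1 ^ (-(1 : ℝ) / 2) * betaKernel ((p : ℝ) / 2) z.2))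
    (by fun_prop) ((ENNReal.measurable_ofReal.comp hf).comp hm)
  simp only [Function.comp_apply, Pi.mul_apply] at h
  rw [divNormMixing, lintegral_map (by fun_prop) hm, h]
  refine lintegral_congr_ae ?_
  filter_upwards [ae_prod_Ioi_pos hF] with z ⟨h1, h2⟩
  have := betaKernel_pos ((p : ℝ) / 2) h2
  rw [← ENNReal.ofReal_mul (by positivity)]

theorem lintegral_divNormMixing_of_eq {p : ℕ} {F : Measure ℝ} [SFinite F]
    (hF : ∀ᵐ v ∂F, 0 < v) {f A : ℝ → ℝ} (hf : Measurable f) (hA : Measurable A)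
    (hA0 : ∀ z, 0 < z → 0 ≤ A z) {q : ℝ}
    (h : ∀ z κ, 0 < z → 0 < κ → z ^ (-(1 : ℝ) / 2) * betaKernel ((p : ℝ) / 2) κ
      * f (z / (1 + κ)) = A z * betaKernel q κ) :
    ∫⁻ v, ENNReal.ofReal (f v) ∂(divNormMixing p F)
      = (∫⁻ z, ENNReal.ofReal (A z) ∂F) *
        ∫⁻ κ in Set.Ioi 0, ENNReal.ofReal (betaKernel q κ) := by
  rw [lintegral_divNormMixing hF hf, ← lintegral_prod_mul (by fun_prop) (by fun_prop)]
  refine lintegral_congr_ae ?_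
  filter_upwards [ae_prod_Ioi_pos hF] with z ⟨h1, h2⟩
  rw [h _ _ h1 h2, ENNReal.ofReal_mul (hA0 _ h1)]

theorem lintegral_betaKernel {q : ℝ} (hq : 1 ≤ q) :
    ∫⁻ κ in Set.Ioi 0, ENNReal.ofReal (betaKernel q κ)
      = ENNReal.ofReal (∫ κ in Set.Ioi 0, betaKernel q κ) := by
  rw [ofReal_integral_eq_lintegral_ofReal (integrableOn_betaKernel hq)]
  filter_upwards [ae_restrict_mem measurableSet_Ioi] with κ hκ using (betaKernel_pos q hκ).le

/-- The factor `(1+κ)^(-p/2)` in `betaKernel` cancels the change of normalizing constant from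
variance `z` to `z/(1+κ)`. What is left is the gamma integral of `κ^(-1/2) exp(-bκ)`, equal to
`√(π/b)`, and `z^(-1/2)` removes its dependence on `z`. -/
theorem lintegral_gaussKernel_divNormMixing {p : ℕ} {F : Measure ℝ} [SFinite F]
    (hF : ∀ᵐ v ∂F, 0 < v) {s : EuclideanSpace ℝ (Fin p)} (hs : s ≠ 0) :
    ∫⁻ v, ENNReal.ofReal (gaussKernel p v s) ∂(divNormMixing p F)
      = ENNReal.ofReal (Real.sqrt (2 * Real.pi) / ‖s‖)
        * ∫⁻ z, ENNReal.ofReal (gaussKernel p z s) ∂F := by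
  have hs' : 0 < ‖s‖ := norm_pos_iff.2 hs
  rw [lintegral_divNormMixing hF (by fun_prop), lintegral_prod _ (by fun_prop),
    ← lintegral_const_mul _ (by fun_prop)]
  refine lintegral_congr_ae ?_
  filter_upwards [hF] with z hz
  set b := ‖s‖ ^ 2 / (2 * z) with hb
  have hb0 : 0 < b := by positivity
  have e1 : ∀ κ ∈ Set.Ioi (0 : ℝ), z ^ (-(1 : ℝ) / 2) * betaKernel ((p : ℝ) / 2) κ
      * gaussKernel p (z / (1 + κ)) s
      = z ^ (-(1 : ℝ) / 2) * gaussKernel p z s *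
        (κ ^ ((1 : ℝ) / 2 - 1) * Real.exp (-(b * κ))) := by
    intro κ hκ
    have hκ' : (0 : ℝ) < κ := hκ
    have e2 : (2 * Real.pi * (z / (1 + κ))) ^ (-(p : ℝ) / 2)
        = (2 * Real.pi * z) ^ (-(p : ℝ) / 2) * (1 + κ) ^ ((p : ℝ) / 2) := by
      rw [← mul_div_assoc, Real.div_rpow (by positivity) (by positivity), neg_div,
        Real.rpow_neg (by positivity : (0 : ℝ) ≤ 1 + κ), div_inv_eq_mul]
    have e3 : Real.exp (-‖s‖ ^ 2 / (2 * (z / (1 + κ))))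
        = Real.exp (-‖s‖ ^ 2 / (2 * z)) * Real.exp (-(b * κ)) := by
      rw [← Real.exp_add, hb]; congr 1; field_simp; ring
    have e4 : (1 + κ) ^ (-((p : ℝ) / 2)) * (1 + κ) ^ ((p : ℝ) / 2) = 1 := by
      rw [← Real.rpow_add (by positivity)]; simp
    have e5 : (1 : ℝ) / 2 - 1 = -1 / 2 := by norm_num
    rw [gaussKernel, gaussKernel, betaKernel, e2, e3, e5]
    linear_combination (z ^ (-(1 : ℝ) / 2) * κ ^ (-(1 : ℝ) / 2) *
      (2 * Real.pi * z) ^ (-(p : ℝ) / 2) * Real.exp (-‖s‖ ^ 2 / (2 * z))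
      * Real.exp (-(b * κ))) * e4
  have hg : 0 ≤ z ^ (-(1 : ℝ) / 2) * gaussKernel p z s := by
    have := gaussKernel_pos hz s
    positivity
  have hval := Real.integral_rpow_mul_exp_neg_mul_Ioi (a := 1 / 2) (r := b) (by norm_num) hb0
  have hint : IntegrableOn (fun κ : ℝ => κ ^ ((1 : ℝ) / 2 - 1) * Real.exp (-(b * κ)))
      (Set.Ioi 0) := by
    -- Without integrability the integral would be `0`, but its value is positive.
    by_contra hc
    rw [integral_undef hc, Real.Gamma_one_half_eq] at hval
    have : 0 < (1 / b) ^ ((1 : ℝ) / 2) * Real.sqrt Real.pi := by positivity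
    linarith
  rw [setLIntegral_congr_fun measurableSet_Ioi (fun κ hκ => congrArg ENNReal.ofReal (e1 κ hκ)),
    ← ofReal_integral_eq_lintegral_ofReal (hint.const_mul _), integral_const_mul, hval,
    ← ENNReal.ofReal_mul (by positivity)]
  · congr 1
    rw [Real.Gamma_one_half_eq, hb, ← Real.sqrt_eq_rpow, one_div_div, Real.sqrt_div (by positivity),
      Real.sqrt_sq hs'.le, neg_div, Real.rpow_neg hz.le, ← Real.sqrt_eq_rpow,
      Real.sqrt_mul (by norm_num), Real.sqrt_mul (by norm_num)]
    have := (Real.sqrt_pos.2 hz).ne'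
    field_simp
  · filter_upwards [ae_restrict_mem measurableSet_Ioi] with κ hκ
    have hκ' : (0 : ℝ) < κ := hκ
    positivity

/-- The mixing law of the density proportional to `s ↦ ‖s‖⁻¹ snDensity p F s`. -/
noncomputable def divNormLaw (p : ℕ) (F : Measure ℝ) : Measure ℝ :=
  (divNormMixing p F Set.univ)⁻¹ • divNormMixing p F

theorem integral_rpow_pos {F : Measure ℝ} [IsProbabilityMeasure F] (hF : ∀ᵐ v ∂F, 0 < v) {t : ℝ}
    (hi : Integrable (fun v => v ^ t) F) : 0 < ∫ v, v ^ t ∂F := by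
  rw [integral_pos_iff_support_of_nonneg_ae _ hi]
  · rw [pos_iff_ne_zero]
    intro h0
    have : ∀ᵐ w ∂F, False := by
      filter_upwards [hF, measure_eq_zero_iff_ae_notMem.1 h0] with w h1 h2
      exact h2 (Real.rpow_pos_of_pos h1 t).ne'
    simp only [Filter.eventually_false_iff_eq_bot, ae_eq_bot] at this
    exact IsProbabilityMeasure.ne_zero F this
  · filter_upwards [hF] with w hw using (Real.rpow_pos_of_pos hw t).le

theorem lintegral_ofReal_rpow {F : Measure ℝ} (hF : ∀ᵐ v ∂F, 0 < v) {t : ℝ}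
    (hi : Integrable (fun v => v ^ t) F) :
    ∫⁻ v, ENNReal.ofReal (v ^ t) ∂F = ENNReal.ofReal (∫ v, v ^ t ∂F) := by
  rw [ofReal_integral_eq_lintegral_ofReal hi]
  filter_upwards [hF] with w hw using (Real.rpow_pos_of_pos hw t).le

/-- For `v = z/(1+κ)` the power `v^t` splits into `z^t` and `(1+κ)^(-t)`, so the moment is a moment
of `F` times a beta integral with parameter shifted by `t`. -/
theorem lintegral_divNormMixing_rpow {p : ℕ} {F : Measure ℝ} [SFinite F]
    (hF : ∀ᵐ v ∂F, 0 < v) {t : ℝ} (hi : Integrable (fun z => z ^ (t - 1 / 2)) F)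
    (hq : 1 ≤ (p : ℝ) / 2 + t) :
    ∫⁻ v, ENNReal.ofReal (v ^ t) ∂(divNormMixing p F)
      = ENNReal.ofReal ((∫ z, z ^ (t - 1 / 2) ∂F) *
        ∫ κ in Set.Ioi 0, betaKernel ((p : ℝ) / 2 + t) κ) := by
  have h0 : 0 ≤ ∫ z, z ^ (t - 1 / 2) ∂F := by
    refine integral_nonneg_of_ae ?_
    filter_upwards [hF] with z hz using Real.rpow_nonneg hz.le _
  rw [ENNReal.ofReal_mul h0, ← lintegral_betaKernel hq, ← lintegral_ofReal_rpow hF hi]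
  refine lintegral_divNormMixing_of_eq hF (by fun_prop) (by fun_prop)
    (fun z hz => Real.rpow_nonneg hz.le _) fun z κ hz hκ => ?_
  rw [betaKernel, betaKernel, Real.div_rpow hz.le (by positivity), sub_eq_add_neg,
    Real.rpow_add hz, neg_add, Real.rpow_add (by positivity : 0 < 1 + κ),
    Real.rpow_neg (by positivity : 0 ≤ 1 + κ) t, neg_div]
  field_simp

section
variable {p : ℕ} {F : Measure ℝ}

theorem divNormMixing_univ (hp : 1 < p) (hF : IsMixing p F) :
    divNormMixing p F Set.univ = ENNReal.ofReal ((∫ z, z ^ (-(1 : ℝ) / 2) ∂F) *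
        ∫ κ in Set.Ioi 0, betaKernel ((p : ℝ) / 2) κ) := by
  have := hF.isProb
  have hp' : (2 : ℝ) ≤ p := by exact_mod_cast hp
  have e : (0 : ℝ) - 1 / 2 = -1 / 2 := by norm_num
  have h := lintegral_divNormMixing_rpow (p := p) hF.pos (t := 0)
    (by rw [e]; exact hF.integrable_rpow (by norm_num) (by linarith)) (by linarith)
  simpa only [Real.rpow_zero, ENNReal.ofReal_one, lintegral_one, add_zero, e] using h

theorem divNormMass_pos (hp : 1 < p) (hF : IsMixing p F) :
    0 < (∫ z, z ^ (-(1 : ℝ) / 2) ∂F) * ∫ κ in Set.Ioi 0, betaKernel ((p : ℝ) / 2) κ := by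
  have := hF.isProb
  have hp' : (2 : ℝ) ≤ p := by exact_mod_cast hp
  exact mul_pos (integral_rpow_pos hF.pos (hF.integrable_rpow (by norm_num) (by linarith)))
    (integral_betaKernel_pos (by linarith))

theorem divNormMixing_univ_ne_zero (hp : 1 < p) (hF : IsMixing p F) :
    divNormMixing p F Set.univ ≠ 0 := by
  rw [divNormMixing_univ hp hF]
  exact (ENNReal.ofReal_pos.2 (divNormMass_pos hp hF)).ne'

theorem divNormMixing_univ_ne_top (hp : 1 < p) (hF : IsMixing p F) :
    divNormMixing p F Set.univ ≠ ∞ := by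
  rw [divNormMixing_univ hp hF]
  exact ENNReal.ofReal_ne_top

theorem isProbabilityMeasure_divNormLaw (hp : 1 < p) (hF : IsMixing p F) :
    IsProbabilityMeasure (divNormLaw p F) := by
  constructor
  rw [divNormLaw, Measure.smul_apply, smul_eq_mul]
  exact ENNReal.inv_mul_cancel (divNormMixing_univ_ne_zero hp hF)
    (divNormMixing_univ_ne_top hp hF)

theorem divNormLaw_pos (hF : IsMixing p F) : ∀ᵐ v ∂(divNormLaw p F), 0 < v := by
  have := hF.isProb
  exact Measure.ae_smul_measure (divNormMixing_pos hF.pos) _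

theorem lintegral_gaussKernel_divNormMixing_lt_top (hF : IsMixing p F)
    {s : EuclideanSpace ℝ (Fin p)} (hs : s ≠ 0) :
    ∫⁻ v, ENNReal.ofReal (gaussKernel p v s) ∂(divNormMixing p F) < ∞ := by
  have := hF.isProb
  rw [lintegral_gaussKernel_divNormMixing hF.pos hs]
  exact ENNReal.mul_lt_top ENNReal.ofReal_lt_top (lintegral_gaussKernel_lt_top hF s)

theorem snDensity_divNormMixing (hF : IsMixing p F) {s : EuclideanSpace ℝ (Fin p)}
    (hs : s ≠ 0) : snDensity p (divNormMixing p F) s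
      = Real.sqrt (2 * Real.pi) / ‖s‖ * snDensity p F s := by
  have := hF.isProb
  rw [snDensity_eq_toReal (divNormMixing_pos hF.pos), snDensity_eq_toReal hF.pos,
    lintegral_gaussKernel_divNormMixing hF.pos hs, ENNReal.toReal_mul,
    ENNReal.toReal_ofReal (by positivity)]

theorem ae_ne_euclidean (hp : 0 < p) (a : EuclideanSpace ℝ (Fin p)) :
    ∀ᵐ s : EuclideanSpace ℝ (Fin p), s ≠ a := by
  have : Nonempty (Fin p) := ⟨⟨0, hp⟩⟩
  exact Measure.ae_ne volume a

theorem integral_div_norm_snDensity (hp : 1 < p) (hF : IsMixing p F) :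
    ∫ t : EuclideanSpace ℝ (Fin p), 1 / ‖t‖ * snDensity p F t
      = (divNormMixing p F).real Set.univ / Real.sqrt (2 * Real.pi) := by
  have := hF.isProb
  have : IsFiniteMeasure (divNormMixing p F) := ⟨(divNormMixing_univ_ne_top hp hF).lt_top⟩
  have h0 : 0 < Real.sqrt (2 * Real.pi) := by positivity
  rw [← integral_snDensity (p := p) (divNormMixing_pos hF.pos), ← integral_div]
  · refine integral_congr_ae ?_
    filter_upwards [ae_ne_euclidean (by omega) 0] with t ht
    rw [snDensity_divNormMixing hF ht]
    field_simp
  · filter_upwards [ae_ne_euclidean (by omega) 0] with t ht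
    exact lintegral_gaussKernel_divNormMixing_lt_top hF ht

theorem divNormMixing_real_pos (hp : 1 < p) (hF : IsMixing p F) :
    0 < (divNormMixing p F).real Set.univ :=
  ENNReal.toReal_pos (divNormMixing_univ_ne_zero hp hF) (divNormMixing_univ_ne_top hp hF)

theorem lintegral_divNormLaw_rpow (hp : 1 < p) (hF : IsMixing p F) {t : ℝ}
    (hi : Integrable (fun z => z ^ (t - 1 / 2)) F) (hq : 1 ≤ (p : ℝ) / 2 + t) :
    ∫⁻ v, ENNReal.ofReal (v ^ t) ∂(divNormLaw p F)
      = ENNReal.ofReal (((∫ z, z ^ (t - 1 / 2) ∂F) *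
        ∫ κ in Set.Ioi 0, betaKernel ((p : ℝ) / 2 + t) κ) / ((∫ z, z ^ (-(1 : ℝ) / 2) ∂F) *
        ∫ κ in Set.Ioi 0, betaKernel ((p : ℝ) / 2) κ)) := by
  have := hF.isProb
  rw [divNormLaw, lintegral_smul_measure, lintegral_divNormMixing_rpow hF.pos hi hq,
    divNormMixing_univ hp hF, smul_eq_mul, ENNReal.ofReal_div_of_pos (divNormMass_pos hp hF),
    ENNReal.div_eq_inv_mul]

theorem integrable_divNormLaw_rpow (hp : 1 < p) (hF : IsMixing p F) {t : ℝ}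
    (hi : Integrable (fun z => z ^ (t - 1 / 2)) F) (hq : 1 ≤ (p : ℝ) / 2 + t) :
    Integrable (fun v => v ^ t) (divNormLaw p F) := by
  refine ⟨(by fun_prop : Measurable fun v : ℝ => v ^ t).aestronglyMeasurable, ?_⟩
  rw [hasFiniteIntegral_iff_ofReal, lintegral_divNormLaw_rpow hp hF hi hq]
  · exact ENNReal.ofReal_lt_top
  · filter_upwards [divNormLaw_pos hF] with v hv using Real.rpow_nonneg hv.le t

theorem integral_divNormLaw_rpow (hp : 1 < p) (hF : IsMixing p F) {t : ℝ}
    (hi : Integrable (fun z => z ^ (t - 1 / 2)) F) (hq : 1 ≤ (p : ℝ) / 2 + t) :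
    ∫ v, v ^ t ∂(divNormLaw p F)
      = ((∫ z, z ^ (t - 1 / 2) ∂F) *
        ∫ κ in Set.Ioi 0, betaKernel ((p : ℝ) / 2 + t) κ) / ((∫ z, z ^ (-(1 : ℝ) / 2) ∂F) *
        ∫ κ in Set.Ioi 0, betaKernel ((p : ℝ) / 2) κ) := by
  have := hF.isProb
  rw [integral_eq_lintegral_of_nonneg_ae, lintegral_divNormLaw_rpow hp hF hi hq,
    ENNReal.toReal_ofReal]
  · refine div_nonneg (mul_nonneg ?_ (integral_betaKernel_pos hq).le) (divNormMass_pos hp hF).le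
    exact (integral_rpow_pos hF.pos hi).le
  · filter_upwards [divNormLaw_pos hF] with v hv using Real.rpow_nonneg hv.le t
  · exact (by fun_prop : Measurable fun v : ℝ => v ^ t).aestronglyMeasurable

theorem integral_inv_divNormLaw (hp : 4 ≤ p) (hF : IsMixing p F)
    (hi : Integrable (fun z => z ^ (-(3 : ℝ) / 2)) F) :
    ∫ v, v⁻¹ ∂(divNormLaw p F) = ((p : ℝ) - 2) / (p - 3) *
      ((∫ z, z ^ (-(3 : ℝ) / 2) ∂F) / ∫ z, z ^ (-(1 : ℝ) / 2) ∂F) := by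
  have := hF.isProb
  have hp' : (4 : ℝ) ≤ p := by exact_mod_cast hp
  have e : (-1 : ℝ) - 1 / 2 = -3 / 2 := by norm_num
  have h := integral_divNormLaw_rpow (by omega) hF (t := -1) (by rwa [e]) (by linarith)
  simp only [Real.rpow_neg_one, e] at h
  -- The recursion is used at `q = p/2 - 1`; its condition `q ≥ 1` is `p ≥ 4`.
  have h2 := integral_betaKernel_succ (q := (p : ℝ) / 2 + -1) (by linarith)
  rw [show (p : ℝ) / 2 + -1 + 1 = p / 2 by ring] at h2
  have h3 := integral_betaKernel_pos (q := (p : ℝ) / 2) (by linarith)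
  have h4 := integral_rpow_pos hF.pos (hF.integrable_rpow (t := -(1 : ℝ) / 2)
    (by norm_num) (by linarith))
  have h5 : (0 : ℝ) < p - 3 := by linarith
  rw [h]
  have h6 : ∫ κ in Set.Ioi 0, betaKernel ((p : ℝ) / 2 + -1) κ
      = ((p : ℝ) - 2) / (p - 3) * ∫ κ in Set.Ioi 0, betaKernel ((p : ℝ) / 2) κ := by
    rw [div_mul_eq_mul_div, eq_div_iff h5.ne']
    linarith
  rw [h6]
  field_simp

end

/-! ### The density `p*` as a scale mixture and as slope times density. -/

section
variable {p : ℕ} {G H : Measure ℝ}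

/-- The mixing law of `pStar`. -/
noncomputable def starLaw (p : ℕ) (G H : Measure ℝ) : Measure ℝ := divNormLaw p (lawZ p G H)

/-- The origin is left out because `pStar` is `0` there through division by zero; it is a null set.
-/
theorem pStar_eq_snDensity (hp : 1 < p) (hG : IsMixing p G) (hH : IsMixing p H)
    {s : EuclideanSpace ℝ (Fin p)} (hs : s ≠ 0) :
    pStar p G H s = snDensity p (starLaw p G H) s := by
  have hF := isMixing_lawZ (by omega) hG hH
  have hs' : 0 < ‖s‖ := norm_pos_iff.2 hs
  have h0 : 0 < Real.sqrt (2 * Real.pi) := by positivity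
  have h1 := divNormMixing_real_pos hp hF
  have h2 : snDensity p (starLaw p G H) s = ((divNormMixing p (lawZ p G H)).real Set.univ)⁻¹
      * snDensity p (divNormMixing p (lawZ p G H)) s := by
    rw [snDensity_eq_integral, starLaw, divNormLaw, integral_smul_measure, ENNReal.toReal_inv]
    rfl
  rw [h2, snDensity_divNormMixing hF hs, pStar, integral_div_norm_snDensity hp hF]
  field_simp

theorem exists_mixtureSlope_mul_eq_pStar (hp : 1 < p) (hG : IsMixing p G) (hH : IsMixing p H) :
    ∃ K : ℝ, 0 < K ∧ ∀ s : EuclideanSpace ℝ (Fin p),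
      mixtureSlope H ‖s‖ * snDensity p G s = K * pStar p G H s := by
  obtain ⟨K, hK, h⟩ := exists_mixtureSlope_mul_snDensity (by omega) hG hH
  have hF := isMixing_lawZ (by omega) hG hH
  have h0 : 0 < Real.sqrt (2 * Real.pi) := by positivity
  have h1 := divNormMixing_real_pos hp hF
  refine ⟨K * ((divNormMixing p (lawZ p G H)).real Set.univ / Real.sqrt (2 * Real.pi)),
    by positivity, fun s => ?_⟩
  rw [h, pStar, integral_div_norm_snDensity hp hF]
  field_simp
end

/-! ### From quadratic risk under `p*` to `L¹` risk. -/

section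
variable {p : ℕ}

theorem integral_locationLaw {f : EuclideanSpace ℝ (Fin p) → ℝ} (hf : Measurable f)
    (hf0 : ∀ x, 0 ≤ f x) (μ : EuclideanSpace ℝ (Fin p)) (g : EuclideanSpace ℝ (Fin p) → ℝ) :
    ∫ x, g x ∂(locationLaw f μ) = ∫ x, f (x - μ) * g x := by
  rw [locationLaw, integral_withDensity_eq_integral_toReal_smul (by fun_prop)
    (Filter.Eventually.of_forall fun _ => ENNReal.ofReal_lt_top)]
  simp only [ENNReal.toReal_ofReal (hf0 _), smul_eq_mul]

theorem integrable_locationLaw {f : EuclideanSpace ℝ (Fin p) → ℝ} (hf : Measurable f)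
    (hf0 : ∀ x, 0 ≤ f x) {μ : EuclideanSpace ℝ (Fin p)} {g : EuclideanSpace ℝ (Fin p) → ℝ} :
    Integrable g (locationLaw f μ) ↔ Integrable fun x => f (x - μ) * g x := by
  rw [locationLaw, integrable_withDensity_iff_integrable_smul' (by fun_prop)
    (Filter.Eventually.of_forall fun _ => ENNReal.ofReal_lt_top)]
  simp only [ENNReal.toReal_ofReal (hf0 _), smul_eq_mul]

theorem ae_locationLaw_of_ae {f : EuclideanSpace ℝ (Fin p) → ℝ}
    {μ : EuclideanSpace ℝ (Fin p)} {q : EuclideanSpace ℝ (Fin p) → Prop} (h : ∀ᵐ x, q x) :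
    ∀ᵐ x ∂(locationLaw f μ), q x :=
  (withDensity_absolutelyContinuous _ _).ae_le h

theorem isProbabilityMeasure_locationLaw {G : Measure ℝ} (hG : IsMixing p G)
    (μ : EuclideanSpace ℝ (Fin p)) : IsProbabilityMeasure (locationLaw (snDensity p G) μ) := by
  have := hG.isProb
  constructor
  rw [locationLaw, withDensity_apply _ MeasurableSet.univ, Measure.restrict_univ,
    lintegral_sub_right_eq_self (fun x => ENNReal.ofReal (snDensity p G x)) μ,
    lintegral_ofReal_snDensity hG.pos
      (Filter.Eventually.of_forall fun x => lintegral_gaussKernel_lt_top hG x), measure_univ]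

theorem l1Risk_plugIn (hp : 0 < p) {H : Measure ℝ} (hH : IsMixing p H)
    (f : EuclideanSpace ℝ (Fin p) → ℝ) (δ : EuclideanSpace ℝ (Fin p) → EuclideanSpace ℝ (Fin p))
    (μ : EuclideanSpace ℝ (Fin p)) :
    l1Risk f (snDensity p H) (plugIn (snDensity p H) δ) μ
      = ∫⁻ x, ENNReal.ofReal (mixtureL1 H ‖δ x - μ‖) ∂(locationLaw f μ) := by
  simp only [l1Risk, plugIn, lintegral_abs_snDensity_sub hp hH]

theorem measurable_pStar {G H : Measure ℝ} (hp : 0 < p) (hG : IsMixing p G)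
    (hH : IsMixing p H) : Measurable (pStar p G H) := by
  have := (isMixing_lawZ hp hG hH).isProb
  unfold pStar
  exact (measurable_const.div measurable_norm).mul measurable_snDensity

theorem pStar_nonneg {G H : Measure ℝ} (hG : IsMixing p G)
    (hH : IsMixing p H) (s : EuclideanSpace ℝ (Fin p)) : 0 ≤ pStar p G H s := by
  have h := snDensity_nonneg (p := p) (lawZ_pos hG hH)
  unfold pStar
  refine mul_nonneg (div_nonneg (inv_nonneg.2 (integral_nonneg fun t => ?_)) (norm_nonneg _)) (h s)
  exact mul_nonneg (by positivity) (h t)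

/-- The `L¹` loss is bounded by `2`, so `L¹` risks are finite for every measurable `δ`. -/
theorem integrable_mixtureL1_comp {H : Measure ℝ} (hH : IsMixing p H)
    {P : Measure (EuclideanSpace ℝ (Fin p))} [IsProbabilityMeasure P]
    {δ : EuclideanSpace ℝ (Fin p) → EuclideanSpace ℝ (Fin p)} (hδ : Measurable δ)
    (μ : EuclideanSpace ℝ (Fin p)) : Integrable (fun x => mixtureL1 H ‖δ x - μ‖) P := by
  have := hH.isProb
  refine Integrable.mono' (integrable_const (2 : ℝ))
    ((measurable_mixtureL1 H).comp (by fun_prop : Measurable fun x =>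
      ‖δ x - μ‖)).aestronglyMeasurable (Filter.Eventually.of_forall fun x => ?_)
  rw [Real.norm_of_nonneg (mixtureL1_nonneg hH.pos (norm_nonneg _))]
  exact mixtureL1_le_two hH.pos (norm_nonneg _)

/-- Comparison of `L¹` predictive risks through quadratic risks under `pStar`. -/
theorem l1Risk_plugIn_comparison {G H : Measure ℝ} (hp : 1 < p) (hG : IsMixing p G)
    (hH : IsMixing p H) {δ : EuclideanSpace ℝ (Fin p) → EuclideanSpace ℝ (Fin p)}
    (hδ : Measurable δ) {μ : EuclideanSpace ℝ (Fin p)}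
    (hi : Integrable (fun x => ‖δ x - μ‖ ^ 2 - ‖x - μ‖ ^ 2) (locationLaw (pStar p G H) μ))
    (hle : ∫ x, (‖δ x - μ‖ ^ 2 - ‖x - μ‖ ^ 2) ∂(locationLaw (pStar p G H) μ) ≤ 0) :
    l1Risk (snDensity p G) (snDensity p H) (plugIn (snDensity p H) δ) μ
      ≤ l1Risk (snDensity p G) (snDensity p H) (plugIn (snDensity p H) fun x => x) μ ∧
    ((∫ x, (‖δ x - μ‖ ^ 2 - ‖x - μ‖ ^ 2) ∂(locationLaw (pStar p G H) μ) < 0 ∨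
      ¬ ∀ᵐ x, ‖δ x - μ‖ = ‖x - μ‖) →
    l1Risk (snDensity p G) (snDensity p H) (plugIn (snDensity p H) δ) μ
      < l1Risk (snDensity p G) (snDensity p H) (plugIn (snDensity p H) fun x => x) μ) := by
  have := hG.isProb
  have := hH.isProb
  have hp0 : 0 < p := by omega
  have hPr := isProbabilityMeasure_locationLaw hG μ
  obtain ⟨K, hK, hKs⟩ := exists_mixtureSlope_mul_eq_pStar hp hG hH
  have hA := integrable_mixtureL1_comp hH (P := locationLaw (snDensity p G) μ) hδ μ
  have hB := integrable_mixtureL1_comp hH (P := locationLaw (snDensity p G) μ) measurable_id μ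
  simp only [id] at hB
  set u : EuclideanSpace ℝ (Fin p) → ℝ := fun x => ‖δ x - μ‖ ^ 2 - ‖x - μ‖ ^ 2 with hu
  have hsn := snDensity_nonneg (p := p) hG.pos
  have hps := pStar_nonneg (p := p) hG hH
  -- The slope turns the density of `X` into a multiple of `p*`, so the tangent bound integrates to
  -- a quadratic risk difference under `p*`.
  have e : ∀ x, snDensity p G (x - μ) * (mixtureSlope H ‖x - μ‖ * u x)
      = K * (pStar p G H (x - μ) * u x) := by
    intro x
    rw [← mul_assoc, mul_comm (snDensity p G _), hKs, mul_assoc]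
  have hg : Integrable (fun x => mixtureSlope H ‖x - μ‖ * u x)
      (locationLaw (snDensity p G) μ) := by
    rw [integrable_locationLaw measurable_snDensity hsn]
    simp only [e]
    exact ((integrable_locationLaw (measurable_pStar hp0 hG hH) hps).1 hi).const_mul K
  have hgi : ∫ x, mixtureSlope H ‖x - μ‖ * u x ∂(locationLaw (snDensity p G) μ)
      = K * ∫ x, u x ∂(locationLaw (pStar p G H) μ) := by
    rw [integral_locationLaw measurable_snDensity hsn,
      integral_locationLaw (measurable_pStar hp0 hG hH) hps, ← integral_const_mul]
    simp only [e]
  have hne : ∀ᵐ x ∂(locationLaw (snDensity p G) μ), 0 < ‖x - μ‖ := by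
    filter_upwards [ae_locationLaw_of_ae (ae_ne_euclidean hp0 μ)] with x hx
    exact norm_pos_iff.2 (sub_ne_zero.2 hx)
  have hAB : ∀ᵐ x ∂(locationLaw (snDensity p G) μ),
      0 ≤ mixtureSlope H ‖x - μ‖ * u x - (mixtureL1 H ‖δ x - μ‖ - mixtureL1 H ‖x - μ‖) := by
    filter_upwards [hne] with x hx
    exact sub_nonneg.2 (mixtureL1_sub_le hp0 hH hx (norm_nonneg _))
  have hsub : Integrable (fun x => mixtureL1 H ‖δ x - μ‖ - mixtureL1 H ‖x - μ‖)
      (locationLaw (snDensity p G) μ) := hA.sub hB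
  have hI := integral_nonneg_of_ae hAB
  rw [integral_sub hg hsub, integral_sub hA hB, hgi] at hI
  have hKle := mul_nonpos_of_nonneg_of_nonpos hK.le hle
  rw [l1Risk_plugIn hp0 hH, l1Risk_plugIn hp0 hH, ← ofReal_integral_eq_lintegral_ofReal hA
    (Filter.Eventually.of_forall fun x => mixtureL1_nonneg hH.pos (norm_nonneg _)),
    ← ofReal_integral_eq_lintegral_ofReal hB
    (Filter.Eventually.of_forall fun x => mixtureL1_nonneg hH.pos (norm_nonneg _))]
  have hle' : ∫ x, mixtureL1 H ‖δ x - μ‖ ∂(locationLaw (snDensity p G) μ)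
      ≤ ∫ x, mixtureL1 H ‖x - μ‖ ∂(locationLaw (snDensity p G) μ) := by linarith
  have h0 : 0 ≤ ∫ x, mixtureL1 H ‖δ x - μ‖ ∂(locationLaw (snDensity p G) μ) :=
    integral_nonneg fun x => mixtureL1_nonneg hH.pos (norm_nonneg _)
  refine ⟨ENNReal.ofReal_le_ofReal hle', fun hor => ?_⟩
  rw [ENNReal.ofReal_lt_ofReal_iff_of_nonneg h0]
  refine lt_of_le_of_ne hle' fun heq => ?_
  rcases hor with hlt | hnot
  · have := mul_neg_of_pos_of_neg hK hlt
    linarith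
  · apply hnot
    have hz : ∫ x, (mixtureSlope H ‖x - μ‖ * u x
        - (mixtureL1 H ‖δ x - μ‖ - mixtureL1 H ‖x - μ‖))
        ∂(locationLaw (snDensity p G) μ) = 0 := by
      rw [integral_sub hg hsub, integral_sub hA hB, hgi]
      linarith
    rw [integral_eq_zero_iff_of_nonneg_ae hAB (hg.sub hsub)] at hz
    -- Equality of the risks means equality in the tangent bound almost surely, which strict
    -- concavity allows only for equal distances.
    have hPeq : ∀ᵐ x ∂(locationLaw (snDensity p G) μ), ‖δ x - μ‖ = ‖x - μ‖ := by
      filter_upwards [hz, hne] with x hx hx'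
      by_contra hcon
      have := mixtureL1_sub_lt hp0 hH hx' (norm_nonneg (δ x - μ)) hcon
      simp only [Pi.zero_apply, hu] at hx
      linarith
    have hm : Measurable fun x => ENNReal.ofReal (snDensity p G (x - μ)) :=
      ENNReal.measurable_ofReal.comp (measurable_snDensity.comp (measurable_id.sub_const μ))
    -- The density of `X` is positive everywhere, so almost surely becomes Lebesgue almost
    -- everywhere.
    rw [locationLaw, ae_withDensity_iff hm] at hPeq
    filter_upwards [hPeq] with x hx
    refine hx (ENNReal.ofReal_pos.2 ?_).ne'
    exact snDensity_pos hG.pos (IsProbabilityMeasure.ne_zero G) (lintegral_gaussKernel_lt_top hG _)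

theorem integrable_sq_norm_sub_of_sqRisk {f : EuclideanSpace ℝ (Fin p) → ℝ}
    {δ : EuclideanSpace ℝ (Fin p) → EuclideanSpace ℝ (Fin p)} (hδ : Measurable δ)
    {μ : EuclideanSpace ℝ (Fin p)} (h : sqRisk f δ μ < ∞) :
    Integrable (fun x => ‖δ x - μ‖ ^ 2) (locationLaw f μ) := by
  refine ⟨(by fun_prop : Measurable fun x => ‖δ x - μ‖ ^ 2).aestronglyMeasurable, ?_⟩
  rw [hasFiniteIntegral_iff_ofReal (Filter.Eventually.of_forall fun x => by positivity)]
  exact h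

theorem integral_sq_norm_sub {f : EuclideanSpace ℝ (Fin p) → ℝ}
    {δ : EuclideanSpace ℝ (Fin p) → EuclideanSpace ℝ (Fin p)} (hδ : Measurable δ)
    (μ : EuclideanSpace ℝ (Fin p)) :
    ∫ x, ‖δ x - μ‖ ^ 2 ∂(locationLaw f μ) = (sqRisk f δ μ).toReal := by
  rw [integral_eq_lintegral_of_nonneg_ae (Filter.Eventually.of_forall fun x => by positivity)
    (by fun_prop : Measurable fun x => ‖δ x - μ‖ ^ 2).aestronglyMeasurable]
  rfl

theorem dominates_plugIn_of_dominates_sqRisk {G H : Measure ℝ} (hp : 1 < p) (hG : IsMixing p G)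
    (hH : IsMixing p H) {δ : EuclideanSpace ℝ (Fin p) → EuclideanSpace ℝ (Fin p)}
    (hδ : Measurable δ) (hfin : ∀ μ, sqRisk (pStar p G H) (fun x => x) μ < ∞)
    (hdom : Dominates (sqRisk (pStar p G H) δ) (sqRisk (pStar p G H) fun x => x)) :
    Dominates
      (l1Risk (snDensity p G) (snDensity p H) (plugIn (snDensity p H) δ))
      (l1Risk (snDensity p G) (snDensity p H) (plugIn (snDensity p H) fun x => x)) := by
  have hfin' : ∀ μ, sqRisk (pStar p G H) δ μ < ∞ := fun μ => (hdom.1 μ).trans_lt (hfin μ)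
  have hi : ∀ μ, Integrable (fun x => ‖δ x - μ‖ ^ 2) (locationLaw (pStar p G H) μ) :=
    fun μ => integrable_sq_norm_sub_of_sqRisk hδ (hfin' μ)
  have hi' : ∀ μ, Integrable (fun x => ‖x - μ‖ ^ 2) (locationLaw (pStar p G H) μ) :=
    fun μ => integrable_sq_norm_sub_of_sqRisk measurable_id (hfin μ)
  have e : ∀ μ, ∫ x, (‖δ x - μ‖ ^ 2 - ‖x - μ‖ ^ 2) ∂(locationLaw (pStar p G H) μ)
      = (sqRisk (pStar p G H) δ μ).toReal - (sqRisk (pStar p G H) (fun x => x) μ).toReal := by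
    intro μ
    rw [integral_sub (hi μ) (hi' μ), integral_sq_norm_sub hδ]
    congr 1
    exact integral_sq_norm_sub measurable_id μ
  have hle : ∀ μ, ∫ x, (‖δ x - μ‖ ^ 2 - ‖x - μ‖ ^ 2) ∂(locationLaw (pStar p G H) μ) ≤ 0 := by
    intro μ
    rw [e, sub_nonpos]
    exact ENNReal.toReal_mono (hfin μ).ne (hdom.1 μ)
  refine ⟨fun μ => (l1Risk_plugIn_comparison hp hG hH hδ ((hi μ).sub (hi' μ)) (hle μ)).1, ?_⟩
  obtain ⟨μ, hμ⟩ := hdom.2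
  refine ⟨μ, (l1Risk_plugIn_comparison hp hG hH hδ ((hi μ).sub (hi' μ)) (hle μ)).2 (Or.inl ?_)⟩
  rw [e, sub_neg]
  exact ENNReal.toReal_strict_mono (hfin μ).ne hμ
end

/-! ### Rearrangement for radially decreasing functions against normal kernels. -/

section
variable {p : ℕ}

/-- A two-point rearrangement: pair `y` with its mirror image under the reflection exchanging `θ`
and `κ θ`. The larger value of `g` and the larger value of the kernel at `κ θ` occur on the same
side. -/
theorem lintegral_mul_gaussKernel_le_of_antitoneOn {g : ℝ → ℝ} (hg : Measurable g)
    (hg0 : ∀ t, 0 ≤ g t) (hganti : AntitoneOn g (Set.Ioi 0)) (hp : 0 < p) {v : ℝ} (hv : 0 < v)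
    (θ : EuclideanSpace ℝ (Fin p)) {κ : ℝ} (hκ : 0 ≤ κ) (hκ1 : κ ≤ 1) :
    ∫⁻ y, ENNReal.ofReal (g ‖y‖ * gaussKernel p v (y - θ))
      ≤ ∫⁻ y, ENNReal.ofReal (g ‖y‖ * gaussKernel p v (y - κ • θ)) := by
  let S := (Submodule.span ℝ {θ})ᗮ.reflection
  have hSS : ∀ y, S (S y) = y := fun y => Submodule.reflection_reflection _ y
  have hSθ : S θ = -θ := Submodule.reflection_orthogonalComplement_singleton_eq_neg θ
  -- The reflection in the hyperplane bisecting `θ` and `κ θ` (for `κ θ = θ`, the one through `θ`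
  -- orthogonal to it; the identity if `θ = 0`).
  let R : EuclideanSpace ℝ (Fin p) → EuclideanSpace ℝ (Fin p) := fun y => S y + (1 + κ) • θ
  have hR : MeasurePreserving R volume volume :=
    (measurePreserving_add_right volume ((1 + κ) • θ)).comp S.measurePreserving
  have hθ1 : ∀ y, ‖R y - θ‖ = ‖y - κ • θ‖ := by
    intro y
    have : R y - θ = S (y - κ • θ) := by
      simp only [R, map_sub, map_smul, hSθ]; module
    rw [this, S.norm_map]
  have hθ2 : ∀ y, ‖R y - κ • θ‖ = ‖y - θ‖ := by
    intro y
    have : R y - κ • θ = S (y - θ) := by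
      simp only [R, map_sub, hSθ]; module
    rw [this, S.norm_map]
  have hm1 : ∀ a : EuclideanSpace ℝ (Fin p),
      Measurable fun y => ENNReal.ofReal (g ‖y‖ * gaussKernel p v (y - a)) := by
    intro a; fun_prop
  have e1 : ∫⁻ y, ENNReal.ofReal (g ‖R y‖ * gaussKernel p v (y - κ • θ))
      = ∫⁻ y, ENNReal.ofReal (g ‖y‖ * gaussKernel p v (y - θ)) := by
    rw [← hR.lintegral_comp (hm1 θ)]
    refine lintegral_congr fun y => ?_
    rw [gaussKernel_congr_norm (hθ1 y)]
  have e2 : ∫⁻ y, ENNReal.ofReal (g ‖R y‖ * gaussKernel p v (y - θ))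
      = ∫⁻ y, ENNReal.ofReal (g ‖y‖ * gaussKernel p v (y - κ • θ)) := by
    rw [← hR.lintegral_comp (hm1 (κ • θ))]
    refine lintegral_congr fun y => ?_
    rw [gaussKernel_congr_norm (hθ2 y)]
  have hsum : ∫⁻ y, (ENNReal.ofReal (g ‖y‖ * gaussKernel p v (y - θ))
        + ENNReal.ofReal (g ‖R y‖ * gaussKernel p v (y - κ • θ)))
      ≤ ∫⁻ y, (ENNReal.ofReal (g ‖y‖ * gaussKernel p v (y - κ • θ))
        + ENNReal.ofReal (g ‖R y‖ * gaussKernel p v (y - θ))) := by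
    refine lintegral_mono_ae ?_
    have hRne : ∀ᵐ y, R y ≠ 0 := hR.quasiMeasurePreserving.ae (ae_ne_euclidean hp 0)
    filter_upwards [ae_ne_euclidean hp 0, hRne] with y hy hRy
    have hy' : ‖y‖ ∈ Set.Ioi (0 : ℝ) := norm_pos_iff.2 hy
    have hRy' : ‖R y‖ ∈ Set.Ioi (0 : ℝ) := norm_pos_iff.2 hRy
    have hinner : inner ℝ (S y) θ = - inner ℝ y θ := by
      have := S.inner_map_map y θ
      rw [hSθ, inner_neg_right] at this
      linarith
    have n1 : ‖R y‖ ^ 2 = ‖y‖ ^ 2 + (1 + κ) * ((1 + κ) * ‖θ‖ ^ 2 - 2 * inner ℝ y θ) := by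
      simp only [R]
      rw [norm_add_sq_real, S.norm_map, inner_smul_right, hinner, norm_smul, mul_pow,
        Real.norm_eq_abs, sq_abs]
      ring
    have n2 : ‖y - θ‖ ^ 2 = ‖y - κ • θ‖ ^ 2
        + (1 - κ) * ((1 + κ) * ‖θ‖ ^ 2 - 2 * inner ℝ y θ) := by
      rw [norm_sub_sq_real, norm_sub_sq_real, inner_smul_right, norm_smul, mul_pow,
        Real.norm_eq_abs, sq_abs]
      ring
    have hnn : ∀ a b, 0 ≤ g a * gaussKernel p v (y - b) :=
      fun a b => mul_nonneg (hg0 a) (gaussKernel_nonneg hv _)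
    rw [← ENNReal.ofReal_add (hnn _ _) (hnn _ _), ← ENNReal.ofReal_add (hnn _ _) (hnn _ _)]
    refine ENNReal.ofReal_le_ofReal ?_
    -- One sign decides both which of `y`, `R y` is closer to the origin and which of `θ`, `κ θ` is
    -- closer to `y`, by `n1` and `n2`; the rearrangement inequality applies in either case.
    rcases le_total 0 ((1 + κ) * ‖θ‖ ^ 2 - 2 * inner ℝ y θ) with h | h
    · have h1 : g ‖R y‖ ≤ g ‖y‖ := by
        refine hganti hy' hRy' (le_of_sq_le_sq ?_ (norm_nonneg _))
        have := mul_nonneg (by linarith : 0 ≤ 1 + κ) h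
        linarith
      have h2 : gaussKernel p v (y - θ) ≤ gaussKernel p v (y - κ • θ) := by
        refine gaussKernel_le hv (le_of_sq_le_sq ?_ (norm_nonneg _))
        have := mul_nonneg (by linarith : 0 ≤ 1 - κ) h
        linarith
      rw [add_comm, add_comm (g ‖y‖ * _)]
      exact mul_add_mul_le_mul_add_mul h1 h2
    · have h1 : g ‖y‖ ≤ g ‖R y‖ := by
        refine hganti hRy' hy' (le_of_sq_le_sq ?_ (norm_nonneg _))
        have := mul_nonpos_of_nonneg_of_nonpos (by linarith : 0 ≤ 1 + κ) h
        linarith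
      have h2 : gaussKernel p v (y - κ • θ) ≤ gaussKernel p v (y - θ) := by
        refine gaussKernel_le hv (le_of_sq_le_sq ?_ (norm_nonneg _))
        have := mul_nonpos_of_nonneg_of_nonpos (by linarith : 0 ≤ 1 - κ) h
        linarith
      exact mul_add_mul_le_mul_add_mul h1 h2
  rw [lintegral_add_left (hm1 θ), lintegral_add_left (hm1 (κ • θ)), e1, e2] at hsum
  -- `hsum` now reads `A + B' ≤ B + A'` with `A = B'` and `B = A'`; halving it by contradiction
  -- avoids subtracting possibly infinite values.
  by_contra hcon
  rw [not_le] at hcon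
  exact absurd (ENNReal.add_lt_add hcon hcon) (not_lt.2 hsum)

theorem integrable_norm_rpow_mul_gaussKernel (hp : 0 < p) {t : ℝ} (ht : -(p : ℝ) < t) {v : ℝ}
    (hv : 0 < v) :
    Integrable fun x : EuclideanSpace ℝ (Fin p) => ‖x‖ ^ t * gaussKernel p v x := by
  have : Nonempty (Fin p) := ⟨⟨0, hp⟩⟩
  have h := (integrable_fun_norm_addHaar (volume : Measure (EuclideanSpace ℝ (Fin p)))
    (f := fun y => y ^ t * Real.exp (-(1 / (2 * v)) * y ^ 2))).2 ?_
  · refine (h.const_mul ((2 * Real.pi * v) ^ (-(p : ℝ) / 2))).congr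
      (Filter.Eventually.of_forall fun x => ?_)
    simp only [gaussKernel]
    have : -‖x‖ ^ 2 / (2 * v) = -(1 / (2 * v)) * ‖x‖ ^ 2 := by field_simp
    rw [this]; ring
  · rw [finrank_euclideanSpace_fin]
    refine (integrableOn_rpow_mul_exp_neg_mul_sq (b := 1 / (2 * v)) (by positivity)
      (s := (p : ℝ) - 1 + t) (by linarith)).congr_fun ?_ measurableSet_Ioi
    intro y hy
    have hy' : (0 : ℝ) < y := hy
    simp only [smul_eq_mul]
    rw [Real.rpow_add hy', ← Nat.cast_pred hp, Real.rpow_natCast, mul_assoc]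

theorem integrable_sq_mul_gaussKernel (hp : 0 < p) {v : ℝ} (hv : 0 < v) :
    Integrable fun x : EuclideanSpace ℝ (Fin p) => ‖x‖ ^ 2 * gaussKernel p v x := by
  have hp' : (0 : ℝ) < p := by exact_mod_cast hp
  simpa using integrable_norm_rpow_mul_gaussKernel hp (t := 2) (by linarith) hv

theorem integrable_inv_sq_mul_gaussKernel (hp : 2 < p) {v : ℝ} (hv : 0 < v) :
    Integrable fun x : EuclideanSpace ℝ (Fin p) => (‖x‖ ^ 2)⁻¹ * gaussKernel p v x := by
  have hp' : (2 : ℝ) < p := by exact_mod_cast hp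
  have h := integrable_norm_rpow_mul_gaussKernel (p := p) (by omega) (t := -2) (by linarith) hv
  simpa [Real.rpow_neg] using h

/-- The comparison with `κ = 0`: moving the mean to the origin can only increase the integral. -/
theorem integrable_mul_gaussKernel_sub {f : ℝ → ℝ} (hf : Measurable f) (hf0 : ∀ t, 0 ≤ f t)
    (hanti : AntitoneOn f (Set.Ioi 0)) (hp : 0 < p) {v : ℝ} (hv : 0 < v)
    (hi : Integrable fun y : EuclideanSpace ℝ (Fin p) => f ‖y‖ * gaussKernel p v y)
    (θ : EuclideanSpace ℝ (Fin p)) :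
    Integrable fun y => f ‖y‖ * gaussKernel p v (y - θ) := by
  have hm : Measurable fun y => f ‖y‖ * gaussKernel p v (y - θ) := by fun_prop
  have hnn : ∀ θ y, 0 ≤ f ‖y‖ * gaussKernel p v (y - θ) :=
    fun θ y => mul_nonneg (hf0 _) (gaussKernel_nonneg hv _)
  refine ⟨hm.aestronglyMeasurable, ?_⟩
  have h2 := hi.2
  rw [hasFiniteIntegral_iff_ofReal (Filter.Eventually.of_forall fun y =>
    mul_nonneg (hf0 _) (gaussKernel_nonneg hv _))] at h2
  rw [hasFiniteIntegral_iff_ofReal (Filter.Eventually.of_forall (hnn θ))]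
  have h := lintegral_mul_gaussKernel_le_of_antitoneOn hf hf0 hanti hp hv θ le_rfl zero_le_one
  simp only [zero_smul, sub_zero] at h
  exact h.trans_lt h2

/-- The integral of a radially decreasing function against a normal density decreases as the
mean moves away from the origin. -/
theorem integral_mul_gaussKernel_le_of_antitoneOn {f : ℝ → ℝ} (hf : Measurable f)
    (hf0 : ∀ t, 0 ≤ f t) (hanti : AntitoneOn f (Set.Ioi 0)) (hp : 0 < p) {v : ℝ} (hv : 0 < v)
    (hi : Integrable fun y : EuclideanSpace ℝ (Fin p) => f ‖y‖ * gaussKernel p v y)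
    (θ : EuclideanSpace ℝ (Fin p)) {κ : ℝ} (hκ : 0 ≤ κ) (hκ1 : κ ≤ 1) :
    ∫ y, f ‖y‖ * gaussKernel p v (y - θ) ≤ ∫ y, f ‖y‖ * gaussKernel p v (y - κ • θ) := by
  have hnn : ∀ θ y, 0 ≤ f ‖y‖ * gaussKernel p v (y - θ) :=
    fun θ y => mul_nonneg (hf0 _) (gaussKernel_nonneg hv _)
  have hI := integrable_mul_gaussKernel_sub hf hf0 hanti hp hv hi
  have h := lintegral_mul_gaussKernel_le_of_antitoneOn hf hf0 hanti hp hv θ hκ hκ1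
  rw [← ofReal_integral_eq_lintegral_ofReal (hI θ) (Filter.Eventually.of_forall (hnn θ)),
    ← ofReal_integral_eq_lintegral_ofReal (hI (κ • θ))
      (Filter.Eventually.of_forall (hnn (κ • θ)))] at h
  exact (ENNReal.ofReal_le_ofReal_iff (integral_nonneg (hnn (κ • θ)))).1 h

theorem gaussKernel_smul {v : ℝ} (hv : 0 < v) (y : EuclideanSpace ℝ (Fin p)) :
    gaussKernel p v (Real.sqrt v • y) = v ^ (-(p : ℝ) / 2) * gaussKernel p 1 y := by
  rw [gaussKernel, gaussKernel, norm_smul, mul_pow, Real.norm_eq_abs, sq_abs, Real.sq_sqrt hv.le,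
    Real.mul_rpow (by positivity) hv.le]
  have : -(v * ‖y‖ ^ 2) / (2 * v) = -‖y‖ ^ 2 / (2 * 1) := by field_simp
  simp only [this, mul_one]; ring

theorem integral_mul_gaussKernel_eq_standard (g : EuclideanSpace ℝ (Fin p) → ℝ) {v : ℝ}
    (hv : 0 < v) (μ : EuclideanSpace ℝ (Fin p)) :
    ∫ x, g x * gaussKernel p v (x - μ)
      = ∫ y, g (Real.sqrt v • y) * gaussKernel p 1 (y - (Real.sqrt v)⁻¹ • μ) := by
  have hs : 0 < Real.sqrt v := Real.sqrt_pos.2 hv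
  have h := Measure.integral_comp_smul (volume : Measure (EuclideanSpace ℝ (Fin p)))
    (fun x => g x * gaussKernel p v (x - μ)) (Real.sqrt v)
  have e : ∀ y, g (Real.sqrt v • y) * gaussKernel p v (Real.sqrt v • y - μ)
      = v ^ (-(p : ℝ) / 2) *
        (g (Real.sqrt v • y) * gaussKernel p 1 (y - (Real.sqrt v)⁻¹ • μ)) := by
    intro y
    have : Real.sqrt v • y - μ = Real.sqrt v • (y - (Real.sqrt v)⁻¹ • μ) := by
      rw [smul_sub, smul_inv_smul₀ hs.ne']
    rw [this, gaussKernel_smul hv]; ring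
  simp only [e] at h
  rw [integral_const_mul, finrank_euclideanSpace_fin, smul_eq_mul] at h
  have e2 : |(Real.sqrt v ^ p)⁻¹| = v ^ (-(p : ℝ) / 2) := by
    rw [abs_of_pos (by positivity), Real.sqrt_eq_rpow, ← Real.rpow_mul_natCast hv.le,
      ← Real.rpow_neg hv.le]
    congr 1; ring
  rw [e2] at h
  exact (mul_left_cancel₀ (Real.rpow_pos_of_pos hv _).ne' h).symm
end

/-! ### Shrinkage profiles and Stein's inequality. -/

/-- Shrinkage functions of Baranchik type. -/
structure IsShrinkage (r : ℝ → ℝ) : Prop where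
  mono : Monotone r
  nonneg : ∀ t, 0 ≤ r t
  le_one : ∀ t, r t ≤ 1
  anti : AntitoneOn (fun t => r t / t) (Set.Ioi 0)

theorem isShrinkage_one : IsShrinkage fun _ => 1 where
  mono := monotone_const
  nonneg := fun _ => zero_le_one
  le_one := fun _ => le_rfl
  anti := fun _ ha _ _ hab => one_div_le_one_div_of_le ha hab

/-- The radial profile `t ↦ r (v t²) / t²`. -/
noncomputable def shrinkProfile (r : ℝ → ℝ) (v t : ℝ) : ℝ := r (v * t ^ 2) / t ^ 2

section
variable {p : ℕ} {r : ℝ → ℝ}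

theorem IsShrinkage.measurable_profile (hr : IsShrinkage r) (v : ℝ) :
    Measurable (shrinkProfile r v) := by
  have := hr.mono.measurable
  unfold shrinkProfile; fun_prop

theorem IsShrinkage.profile_nonneg (hr : IsShrinkage r) (v t : ℝ) : 0 ≤ shrinkProfile r v t :=
  div_nonneg (hr.nonneg _) (by positivity)

theorem IsShrinkage.profile_le (hr : IsShrinkage r) (v t : ℝ) :
    shrinkProfile r v t ≤ (t ^ 2)⁻¹ := by
  rw [← one_div]
  exact div_le_div_of_nonneg_right (hr.le_one _) (by positivity)

theorem IsShrinkage.profile_mono (hr : IsShrinkage r) {v v' : ℝ} (h : v ≤ v') (t : ℝ) :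
    shrinkProfile r v t ≤ shrinkProfile r v' t :=
  div_le_div_of_nonneg_right (hr.mono (by gcongr)) (by positivity)

theorem IsShrinkage.profile_anti (hr : IsShrinkage r) {v : ℝ} (hv : 0 < v) :
    AntitoneOn (shrinkProfile r v) (Set.Ioi 0) := by
  intro a ha b hb hab
  have ha' : (0 : ℝ) < a := ha
  have hb' : (0 : ℝ) < b := hb
  have e : ∀ t, 0 < t → shrinkProfile r v t = v * (r (v * t ^ 2) / (v * t ^ 2)) := by
    intro t ht
    unfold shrinkProfile; field_simp
  rw [e a ha', e b hb']
  refine mul_le_mul_of_nonneg_left ?_ hv.le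
  exact hr.anti (Set.mem_Ioi.2 (by positivity)) (Set.mem_Ioi.2 (by positivity)) (by gcongr)

theorem IsShrinkage.integrable_profile (hr : IsShrinkage r) (hp : 2 < p) (c : ℝ)
    {v : ℝ} (hv : 0 < v) (θ : EuclideanSpace ℝ (Fin p)) :
    Integrable fun y => shrinkProfile r c ‖y‖ * gaussKernel p v (y - θ) := by
  have h1 : Integrable fun y : EuclideanSpace ℝ (Fin p) =>
      (‖y‖ ^ 2)⁻¹ * gaussKernel p v (y - θ) := by
    refine integrable_mul_gaussKernel_sub (f := fun t => (t ^ 2)⁻¹) (by fun_prop)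
      (fun t => by positivity) ?_ (by omega) hv (integrable_inv_sq_mul_gaussKernel hp hv) θ
    intro a ha b hb hab
    have ha' : (0 : ℝ) < a := ha
    simp only
    gcongr
  have hm := hr.measurable_profile c
  refine Integrable.mono' h1 (by fun_prop : Measurable fun y =>
    shrinkProfile r c ‖y‖ * gaussKernel p v (y - θ)).aestronglyMeasurable
    (Filter.Eventually.of_forall fun y => ?_)
  have hg := gaussKernel_nonneg hv (y - θ)
  rw [Real.norm_of_nonneg (mul_nonneg (hr.profile_nonneg _ _) hg)]
  exact mul_le_mul_of_nonneg_right (hr.profile_le _ _) hg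

/-- `∫ r(‖x‖²)/‖x‖²` against the normal law with mean `μ` and variance `v`. -/
noncomputable def shrinkMean (r : ℝ → ℝ) (μ : EuclideanSpace ℝ (Fin p)) (v : ℝ) : ℝ :=
  ∫ x, shrinkProfile r 1 ‖x‖ * gaussKernel p v (x - μ)

theorem shrinkMean_nonneg (hr : IsShrinkage r) (μ : EuclideanSpace ℝ (Fin p)) {v : ℝ}
    (hv : 0 < v) : 0 ≤ shrinkMean r μ v :=
  integral_nonneg fun _ => mul_nonneg (hr.profile_nonneg _ _) (gaussKernel_nonneg hv _)

theorem mul_shrinkMean_eq (μ : EuclideanSpace ℝ (Fin p)) {v : ℝ} (hv : 0 < v) :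
    v * shrinkMean r μ v
      = ∫ y, shrinkProfile r v ‖y‖ * gaussKernel p 1 (y - (Real.sqrt v)⁻¹ • μ) := by
  rw [shrinkMean, integral_mul_gaussKernel_eq_standard _ hv, ← integral_const_mul]
  refine integral_congr_ae (Filter.Eventually.of_forall fun y => ?_)
  simp only [shrinkProfile]
  rw [norm_smul, mul_pow, Real.norm_eq_abs, sq_abs, Real.sq_sqrt hv.le, one_mul]
  field_simp

/-- After standardization, `v` enters through the profile `r(v‖y‖²)/‖y‖²`, which grows with `v`, and
through the mean `μ/√v`, which moves towards the origin. The profile is radially decreasing, so both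
effects raise the integral. -/
theorem mul_shrinkMean_mono (hr : IsShrinkage r) (hp : 2 < p) (μ : EuclideanSpace ℝ (Fin p))
    {v v' : ℝ} (hv : 0 < v) (hvv : v ≤ v') :
    v * shrinkMean r μ v ≤ v' * shrinkMean r μ v' := by
  have hv' : 0 < v' := hv.trans_le hvv
  have hs : 0 < Real.sqrt v := Real.sqrt_pos.2 hv
  have hs' : 0 < Real.sqrt v' := Real.sqrt_pos.2 hv'
  rw [mul_shrinkMean_eq μ hv, mul_shrinkMean_eq μ hv']
  calc _ ≤ ∫ y, shrinkProfile r v' ‖y‖ * gaussKernel p 1 (y - (Real.sqrt v)⁻¹ • μ) := by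
        refine integral_mono (hr.integrable_profile hp v one_pos _)
          (hr.integrable_profile hp v' one_pos _) fun y => ?_
        exact mul_le_mul_of_nonneg_right (hr.profile_mono hvv _) (gaussKernel_nonneg one_pos _)
    _ ≤ ∫ y, shrinkProfile r v' ‖y‖ *
          gaussKernel p 1 (y - (Real.sqrt v / Real.sqrt v') • ((Real.sqrt v)⁻¹ • μ)) := by
        refine integral_mul_gaussKernel_le_of_antitoneOn (hr.measurable_profile v')
          (hr.profile_nonneg v') (hr.profile_anti hv') (by omega) one_pos ?_ _ (by positivity)
          ((div_le_one hs').2 (Real.sqrt_le_sqrt hvv))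
        simpa using hr.integrable_profile hp v' one_pos (0 : EuclideanSpace ℝ (Fin p))
    _ = _ := by
        rw [smul_smul]
        congr! 6
        field_simp

/-- A bound free of `μ`; with `r = 1` it supplies the `v⁻¹` term of the domination used for Fubini's
theorem. -/
theorem shrinkMean_le_div (hr : IsShrinkage r) (hp : 2 < p) (μ : EuclideanSpace ℝ (Fin p))
    {v : ℝ} (hv : 0 < v) :
    v * shrinkMean r μ v ≤ ∫ y : EuclideanSpace ℝ (Fin p), (‖y‖ ^ 2)⁻¹ * gaussKernel p 1 y := by
  rw [mul_shrinkMean_eq μ hv]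
  have h1 := isShrinkage_one.integrable_profile hp v one_pos ((Real.sqrt v)⁻¹ • μ)
  have h0 := isShrinkage_one.integrable_profile hp v one_pos (0 : EuclideanSpace ℝ (Fin p))
  have h := integral_mul_gaussKernel_le_of_antitoneOn (isShrinkage_one.measurable_profile v)
    (isShrinkage_one.profile_nonneg v) (isShrinkage_one.profile_anti hv) (by omega) one_pos
    (by simpa using h0) ((Real.sqrt v)⁻¹ • μ) le_rfl zero_le_one
  simp only [zero_smul, sub_zero] at h
  have e : ∀ y : EuclideanSpace ℝ (Fin p), shrinkProfile (fun _ => 1) v ‖y‖ = (‖y‖ ^ 2)⁻¹ :=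
    fun y => by simp [shrinkProfile]
  simp only [e] at h h1
  refine (integral_mono (hr.integrable_profile hp v one_pos _) h1 fun y => ?_).trans h
  exact mul_le_mul_of_nonneg_right (hr.profile_le _ _) (gaussKernel_nonneg one_pos _)

/-- Cauchy–Schwarz and `r ≤ 1` give `‖x‖⁻¹ ‖x - μ‖`, which is split by the inequality of the means.
-/
theorem abs_profile_mul_inner_le (hr : IsShrinkage r) (x μ : EuclideanSpace ℝ (Fin p)) :
    |shrinkProfile r 1 ‖x‖ * inner ℝ x (x - μ)|
      ≤ shrinkProfile (fun _ => 1) 1 ‖x‖ + ‖x - μ‖ ^ 2 := by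
  have h1 := abs_real_inner_le_norm x (x - μ)
  have hw := hr.profile_nonneg 1 ‖x‖
  have hw1 := hr.profile_le 1 ‖x‖
  rw [abs_mul, abs_of_nonneg hw]
  have e : shrinkProfile (fun _ => 1) 1 ‖x‖ = (‖x‖⁻¹) ^ 2 := by simp [shrinkProfile]
  rw [e]
  rw [← inv_pow] at hw1
  calc _ ≤ (‖x‖⁻¹) ^ 2 * (‖x‖ * ‖x - μ‖) := by gcongr
    _ ≤ ‖x‖⁻¹ * ‖x - μ‖ := by
        rcases eq_or_ne ‖x‖ 0 with h | h
        · simp [h]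
        · apply le_of_eq; field_simp
    _ ≤ _ := by nlinarith [sq_nonneg (‖x‖⁻¹ - ‖x - μ‖), sq_nonneg (‖x‖⁻¹), sq_nonneg ‖x - μ‖]

theorem integrable_sq_norm_sub_mul_gaussKernel (hp : 0 < p) {v : ℝ} (hv : 0 < v)
    (μ : EuclideanSpace ℝ (Fin p)) :
    Integrable fun x => ‖x - μ‖ ^ 2 * gaussKernel p v (x - μ) :=
  (integrable_sq_mul_gaussKernel hp hv).comp_sub_right μ

theorem integral_sq_norm_sub_mul_gaussKernel {v : ℝ} (hv : 0 < v)
    (μ : EuclideanSpace ℝ (Fin p)) :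
    ∫ x, ‖x - μ‖ ^ 2 * gaussKernel p v (x - μ)
      = v * ∫ y : EuclideanSpace ℝ (Fin p), ‖y‖ ^ 2 * gaussKernel p 1 y := by
  rw [integral_sub_right_eq_self (fun x => ‖x‖ ^ 2 * gaussKernel p v x) μ]
  have h := integral_mul_gaussKernel_eq_standard (fun x : EuclideanSpace ℝ (Fin p) => ‖x‖ ^ 2) hv 0
  simp only [sub_zero, smul_zero] at h
  rw [h, ← integral_const_mul]
  refine integral_congr_ae (Filter.Eventually.of_forall fun y => ?_)
  simp only
  rw [norm_smul, mul_pow, Real.norm_eq_abs, sq_abs, Real.sq_sqrt hv.le, mul_assoc]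

theorem integrable_profile_mul_inner (hr : IsShrinkage r) (hp : 2 < p) {v : ℝ} (hv : 0 < v)
    (μ : EuclideanSpace ℝ (Fin p)) :
    Integrable fun x => shrinkProfile r 1 ‖x‖ * inner ℝ x (x - μ) * gaussKernel p v (x - μ) := by
  have hm := hr.measurable_profile 1
  refine Integrable.mono' ((isShrinkage_one.integrable_profile hp 1 hv μ).add
    (integrable_sq_norm_sub_mul_gaussKernel (by omega) hv μ)) (by fun_prop : Measurable fun x =>
    shrinkProfile r 1 ‖x‖ * inner ℝ x (x - μ) * gaussKernel p v (x - μ)).aestronglyMeasurable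
    (Filter.Eventually.of_forall fun x => ?_)
  rw [norm_mul, Real.norm_eq_abs, Real.norm_of_nonneg (gaussKernel_nonneg hv _)]
  simp only [Pi.add_apply]
  rw [← add_mul]
  exact mul_le_mul_of_nonneg_right (abs_profile_mul_inner_le hr x μ) (gaussKernel_nonneg hv _)

/-- Expand the square and use `exp u ≥ 1 + u`. The term linear in `ε` carries the inner product of
Stein's identity. -/
theorem gaussKernel_sub_ge {v : ℝ} (hv : 0 < v) (ε : ℝ) (x μ : EuclideanSpace ℝ (Fin p)) :
    gaussKernel p v (x - μ) * (1 - ε / v * inner ℝ x (x - μ) - ε ^ 2 / (2 * v) * ‖x‖ ^ 2)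
      ≤ gaussKernel p v ((1 + ε) • x - μ) := by
  have e : (1 + ε) • x - μ = (x - μ) + ε • x := by module
  have n : ‖(1 + ε) • x - μ‖ ^ 2 = ‖x - μ‖ ^ 2 + 2 * ε * inner ℝ x (x - μ) + ε ^ 2 * ‖x‖ ^ 2 := by
    rw [e, norm_add_sq_real, inner_smul_right, norm_smul, mul_pow, Real.norm_eq_abs, sq_abs,
      real_inner_comm]
    ring
  have h : gaussKernel p v ((1 + ε) • x - μ) = gaussKernel p v (x - μ) *
      Real.exp (- (ε / v * inner ℝ x (x - μ) + ε ^ 2 / (2 * v) * ‖x‖ ^ 2)) := by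
    rw [gaussKernel, gaussKernel, n,
      mul_assoc _ (Real.exp (-‖x - μ‖ ^ 2 / (2 * v))), ← Real.exp_add]
    congr 2
    field_simp; ring
  rw [h]
  refine mul_le_mul_of_nonneg_left ?_ (gaussKernel_nonneg hv _)
  have := Real.add_one_le_exp (- (ε / v * inner ℝ x (x - μ) + ε ^ 2 / (2 * v) * ‖x‖ ^ 2))
  linarith

theorem profile_inv_smul_le (hr : IsShrinkage r) {t : ℝ} (ht : 1 ≤ t)
    (y : EuclideanSpace ℝ (Fin p)) :
    shrinkProfile r 1 ‖t⁻¹ • y‖ ≤ t ^ 2 * shrinkProfile r 1 ‖y‖ := by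
  have ht0 : 0 < t := by linarith
  have e : ‖t⁻¹ • y‖ ^ 2 = (t ^ 2)⁻¹ * ‖y‖ ^ 2 := by
    rw [norm_smul, mul_pow, Real.norm_eq_abs, sq_abs, inv_pow]
  unfold shrinkProfile
  rw [e, one_mul, one_mul]
  have h1 : r ((t ^ 2)⁻¹ * ‖y‖ ^ 2) ≤ r (‖y‖ ^ 2) := by
    refine hr.mono (mul_le_of_le_one_left (by positivity) (inv_le_one_of_one_le₀ ?_))
    nlinarith
  calc _ ≤ r (‖y‖ ^ 2) / ((t ^ 2)⁻¹ * ‖y‖ ^ 2) := by gcongr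
    _ = _ := by field_simp

theorem integrable_profile_mul_gaussKernel_smul (hr : IsShrinkage r) (hp : 2 < p) {v : ℝ}
    (hv : 0 < v) (μ : EuclideanSpace ℝ (Fin p)) {t : ℝ} (ht : 1 ≤ t) :
    Integrable (fun y => shrinkProfile r 1 ‖t⁻¹ • y‖ * gaussKernel p v (y - μ)) ∧
    Integrable fun x => shrinkProfile r 1 ‖x‖ * gaussKernel p v (t • x - μ) := by
  have ht0 : 0 < t := by linarith
  have hm := hr.measurable_profile 1
  have h1 : Integrable fun y => shrinkProfile r 1 ‖t⁻¹ • y‖ * gaussKernel p v (y - μ) := by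
    refine Integrable.mono' ((hr.integrable_profile hp 1 hv μ).const_mul (t ^ 2))
      (by fun_prop : Measurable fun y =>
        shrinkProfile r 1 ‖t⁻¹ • y‖ * gaussKernel p v (y - μ)).aestronglyMeasurable
      (Filter.Eventually.of_forall fun y => ?_)
    have hg := gaussKernel_nonneg hv (y - μ)
    rw [Real.norm_of_nonneg (mul_nonneg (hr.profile_nonneg _ _) hg), ← mul_assoc]
    exact mul_le_mul_of_nonneg_right (profile_inv_smul_le hr ht y) hg
  refine ⟨h1, ?_⟩
  have h2 := h1.comp_smul ht0.ne'
  simpa only [inv_smul_smul₀ ht0.ne'] using h2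

/-- The change of variables gives `t^(-p)`, and undoing the dilation in the profile costs `t²`
because `r` is non-decreasing; hence the dimension `p - 2`. -/
theorem integral_profile_mul_gaussKernel_smul_le (hr : IsShrinkage r) (hp : 2 < p) {v : ℝ}
    (hv : 0 < v) (μ : EuclideanSpace ℝ (Fin p)) {t : ℝ} (ht : 1 ≤ t) :
    ∫ x, shrinkProfile r 1 ‖x‖ * gaussKernel p v (t • x - μ)
      ≤ (t ^ (p - 2))⁻¹ * shrinkMean r μ v := by
  have ht0 : 0 < t := by linarith
  have h := Measure.integral_comp_smul (volume : Measure (EuclideanSpace ℝ (Fin p)))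
    (fun y => shrinkProfile r 1 ‖t⁻¹ • y‖ * gaussKernel p v (y - μ)) t
  simp only [inv_smul_smul₀ ht0.ne'] at h
  rw [h, finrank_euclideanSpace_fin, abs_of_pos (by positivity), smul_eq_mul]
  have h3 : ∫ y, shrinkProfile r 1 ‖t⁻¹ • y‖ * gaussKernel p v (y - μ)
      ≤ t ^ 2 * shrinkMean r μ v := by
    rw [shrinkMean, ← integral_const_mul]
    refine integral_mono (integrable_profile_mul_gaussKernel_smul hr hp hv μ ht).1
      ((hr.integrable_profile hp 1 hv μ).const_mul (t ^ 2)) fun y => ?_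
    simp only
    rw [← mul_assoc]
    exact mul_le_mul_of_nonneg_right (profile_inv_smul_le hr ht y) (gaussKernel_nonneg hv _)
  calc _ ≤ (t ^ p)⁻¹ * (t ^ 2 * shrinkMean r μ v) := by gcongr
    _ = _ := by
        have : t ^ p = t ^ (p - 2) * t ^ 2 := by rw [← pow_add]; congr 1; omega
        rw [this]; field_simp

/-- An inequality form of Stein's identity for radially shrinking vector fields. -/
theorem stein_inequality (hr : IsShrinkage r) (hp : 2 < p) {v : ℝ} (hv : 0 < v)
    (μ : EuclideanSpace ℝ (Fin p)) :
    ((p : ℝ) - 2) * (v * shrinkMean r μ v)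
      ≤ ∫ x, shrinkProfile r 1 ‖x‖ * inner ℝ x (x - μ) * gaussKernel p v (x - μ) := by
  set S := ∫ x, shrinkProfile r 1 ‖x‖ * inner ℝ x (x - μ) * gaussKernel p v (x - μ) with hS
  set h := shrinkMean r μ v with hh
  have hh0 : 0 ≤ h := shrinkMean_nonneg hr μ hv
  have hn : ((p - 2 : ℕ) : ℝ) = (p : ℝ) - 2 := by rw [Nat.cast_sub (by omega)]; norm_num
  have hn0 : (0 : ℝ) < (p : ℝ) - 2 := by rw [← hn]; exact_mod_cast (by omega : 0 < p - 2)
  -- The integral of the profile against the dilated kernel is bounded above by the dilation lemma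
  -- with Bernoulli's inequality, and below by `gaussKernel_sub_ge`. Dividing by `ε / v` and letting
  -- `ε → 0` replaces integration by parts, so `r` need not be differentiable.
  have key : ∀ ε : ℝ, 0 < ε →
      ((p : ℝ) - 2) * (v * h) ≤ (1 + ((p : ℝ) - 2) * ε) * (S + ε / 2) := by
    intro ε hε
    have hu := integral_profile_mul_gaussKernel_smul_le hr hp hv μ (t := 1 + ε) (by linarith)
    have hb : 1 + ((p : ℝ) - 2) * ε ≤ (1 + ε) ^ (p - 2) := by
      rw [← hn]; exact one_add_mul_le_pow (by linarith) _
    have hpos : 0 < 1 + ((p : ℝ) - 2) * ε := by positivity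
    have hu2 : ((1 + ε) ^ (p - 2))⁻¹ * h ≤ (1 + ((p : ℝ) - 2) * ε)⁻¹ * h := by gcongr
    have i1 := hr.integrable_profile hp 1 hv μ
    have i2 := (integrable_profile_mul_inner hr hp hv μ).const_mul (ε / v)
    have i3 : Integrable fun x => ε ^ 2 / (2 * v) * gaussKernel p v (x - μ) :=
      ((integrable_gaussKernel hv).comp_sub_right μ).const_mul _
    have i12 : Integrable fun x => shrinkProfile r 1 ‖x‖ * gaussKernel p v (x - μ)
        - ε / v * (shrinkProfile r 1 ‖x‖ * inner ℝ x (x - μ) * gaussKernel p v (x - μ)) :=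
      i1.sub i2
    have hl : h - ε / v * S - ε ^ 2 / (2 * v)
        ≤ ∫ x, shrinkProfile r 1 ‖x‖ * gaussKernel p v ((1 + ε) • x - μ) := by
      have e1 : ∫ x, ε ^ 2 / (2 * v) * gaussKernel p v (x - μ) = ε ^ 2 / (2 * v) := by
        rw [integral_const_mul, integral_sub_right_eq_self (gaussKernel p v) μ,
          integral_gaussKernel hv, mul_one]
      calc h - ε / v * S - ε ^ 2 / (2 * v)
          = ∫ x, (shrinkProfile r 1 ‖x‖ * gaussKernel p v (x - μ)
            - ε / v * (shrinkProfile r 1 ‖x‖ * inner ℝ x (x - μ) * gaussKernel p v (x - μ))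
            - ε ^ 2 / (2 * v) * gaussKernel p v (x - μ)) := by
            rw [integral_sub i12 i3, integral_sub i1 i2, integral_const_mul, e1, hh, shrinkMean,
              hS]
        _ ≤ _ := by
            refine integral_mono (i12.sub i3)
              (integrable_profile_mul_gaussKernel_smul hr hp hv μ (by linarith)).2 fun x => ?_
            have hw := hr.profile_nonneg 1 ‖x‖
            have hwx : shrinkProfile r 1 ‖x‖ * ‖x‖ ^ 2 ≤ 1 := by
              calc _ ≤ (‖x‖ ^ 2)⁻¹ * ‖x‖ ^ 2 := by gcongr; exact hr.profile_le _ _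
                _ ≤ 1 := inv_mul_le_one
            have hg := gaussKernel_nonneg hv (x - μ)
            have h1 := mul_le_mul_of_nonneg_left (gaussKernel_sub_ge hv ε x μ) hw
            have h2 : 0 ≤ ε ^ 2 / (2 * v) * gaussKernel p v (x - μ) := by positivity
            have h3 := mul_le_mul_of_nonneg_left hwx h2
            simp only
            nlinarith
    have h4 : h - ε / v * S - ε ^ 2 / (2 * v) ≤ (1 + ((p : ℝ) - 2) * ε)⁻¹ * h :=
      hl.trans (hu.trans hu2)
    have h5 := mul_le_mul_of_nonneg_left h4 hpos.le
    rw [mul_inv_cancel_left₀ hpos.ne'] at h5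
    have h6 : (1 + ((p : ℝ) - 2) * ε) * (ε / v * S + ε ^ 2 / (2 * v))
        = ε / v * ((1 + ((p : ℝ) - 2) * ε) * (S + ε / 2)) := by field_simp
    have h7 : ((p : ℝ) - 2) * ε * h = ε / v * (((p : ℝ) - 2) * (v * h)) := by field_simp
    have h8 : ε / v * (((p : ℝ) - 2) * (v * h))
        ≤ ε / v * ((1 + ((p : ℝ) - 2) * ε) * (S + ε / 2)) := by
      rw [← h6, ← h7]; linarith
    exact le_of_mul_le_mul_left h8 (by positivity)
  have hlim : Filter.Tendsto (fun ε : ℝ => (1 + ((p : ℝ) - 2) * ε) * (S + ε / 2))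
      (nhdsWithin 0 (Set.Ioi 0)) (nhds S) := by
    have hc : Continuous fun ε : ℝ => (1 + ((p : ℝ) - 2) * ε) * (S + ε / 2) := by fun_prop
    have := hc.tendsto 0
    simp only [mul_zero, add_zero, zero_div, one_mul] at this
    exact this.mono_left nhdsWithin_le_nhds
  refine ge_of_tendsto hlim ?_
  filter_upwards [self_mem_nhdsWithin] with ε hε using key ε hε
end

/-! ### Quadratic risk of Baranchik estimators, and part (b). -/

section
variable {p : ℕ} {r : ℝ → ℝ}

theorem sq_norm_baranchik_sub (a : ℝ) (r : ℝ → ℝ) (x μ : EuclideanSpace ℝ (Fin p)) :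
    ‖baranchik a r x - μ‖ ^ 2 - ‖x - μ‖ ^ 2
      = a ^ 2 * (shrinkProfile r 1 ‖x‖ ^ 2 * ‖x‖ ^ 2)
        - 2 * a * (shrinkProfile r 1 ‖x‖ * inner ℝ x (x - μ)) := by
  have e : baranchik a r x - μ = (x - μ) - (a * shrinkProfile r 1 ‖x‖) • x := by
    rw [baranchik, shrinkProfile, one_mul, mul_div_assoc]; module
  rw [e, norm_sub_sq_real, inner_smul_right, norm_smul, mul_pow, Real.norm_eq_abs, sq_abs,
    real_inner_comm]
  ring

theorem profile_sq_mul_le (hr : IsShrinkage r) (x : EuclideanSpace ℝ (Fin p)) :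
    shrinkProfile r 1 ‖x‖ ^ 2 * ‖x‖ ^ 2 ≤ shrinkProfile r 1 ‖x‖ := by
  have hw := hr.profile_nonneg 1 ‖x‖
  have hwx : shrinkProfile r 1 ‖x‖ * ‖x‖ ^ 2 ≤ 1 := by
    calc _ ≤ (‖x‖ ^ 2)⁻¹ * ‖x‖ ^ 2 := by gcongr; exact hr.profile_le _ _
      _ ≤ 1 := inv_mul_le_one
  nlinarith

theorem IsShrinkage.measurable_baranchik (hr : IsShrinkage r) (a : ℝ) :
    Measurable (baranchik (p := p) a r) := by
  have := hr.mono.measurable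
  unfold baranchik; fun_prop

theorem abs_sq_norm_baranchik_sub_le (hr : IsShrinkage r) {a : ℝ} (ha : 0 ≤ a)
    (x μ : EuclideanSpace ℝ (Fin p)) :
    |‖baranchik a r x - μ‖ ^ 2 - ‖x - μ‖ ^ 2|
      ≤ (a ^ 2 + 2 * a) * (shrinkProfile (fun _ => 1) 1 ‖x‖ + ‖x - μ‖ ^ 2) := by
  rw [sq_norm_baranchik_sub]
  have h1 := abs_profile_mul_inner_le hr x μ
  have h2 := profile_sq_mul_le hr x
  have h3 : shrinkProfile r 1 ‖x‖ ≤ shrinkProfile (fun _ => 1) 1 ‖x‖ := by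
    have := hr.profile_le 1 ‖x‖
    simpa [shrinkProfile] using this
  have h4 : 0 ≤ shrinkProfile r 1 ‖x‖ ^ 2 * ‖x‖ ^ 2 := by positivity
  refine (abs_sub _ _).trans ?_
  rw [abs_mul, abs_mul (2 * a), abs_of_nonneg h4, abs_of_nonneg (sq_nonneg a),
    abs_of_nonneg (by positivity : 0 ≤ 2 * a), add_mul]
  refine add_le_add (mul_le_mul_of_nonneg_left ?_ (by positivity))
    (mul_le_mul_of_nonneg_left h1 (by positivity))
  have := sq_nonneg ‖x - μ‖
  linarith

/-- The norm bound is linear in `v⁻¹` and `v`, so finite `E(1/V)` and `E(V)` make the joint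
integrand integrable. -/
theorem integrable_sq_norm_baranchik_sub_mul (hr : IsShrinkage r) (hp : 2 < p) {a : ℝ}
    (ha : 0 ≤ a) {v : ℝ} (hv : 0 < v) (μ : EuclideanSpace ℝ (Fin p)) :
    Integrable (fun x => (‖baranchik a r x - μ‖ ^ 2 - ‖x - μ‖ ^ 2) * gaussKernel p v (x - μ)) ∧
    ∫ x, ‖(‖baranchik a r x - μ‖ ^ 2 - ‖x - μ‖ ^ 2) * gaussKernel p v (x - μ)‖
      ≤ (a ^ 2 + 2 * a) *
        ((∫ y : EuclideanSpace ℝ (Fin p), (‖y‖ ^ 2)⁻¹ * gaussKernel p 1 y) * v⁻¹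
          + (∫ y : EuclideanSpace ℝ (Fin p), ‖y‖ ^ 2 * gaussKernel p 1 y) * v) := by
  have hm := hr.measurable_baranchik (p := p) a
  have i1 := isShrinkage_one.integrable_profile hp 1 hv μ
  have i2 := integrable_sq_norm_sub_mul_gaussKernel (by omega) hv μ
  have i3 : Integrable fun x => (a ^ 2 + 2 * a) *
      (shrinkProfile (fun _ => 1) 1 ‖x‖ * gaussKernel p v (x - μ)
        + ‖x - μ‖ ^ 2 * gaussKernel p v (x - μ)) := (i1.add i2).const_mul _
  have hb : ∀ x, ‖(‖baranchik a r x - μ‖ ^ 2 - ‖x - μ‖ ^ 2) * gaussKernel p v (x - μ)‖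
      ≤ (a ^ 2 + 2 * a) * (shrinkProfile (fun _ => 1) 1 ‖x‖ * gaussKernel p v (x - μ)
        + ‖x - μ‖ ^ 2 * gaussKernel p v (x - μ)) := by
    intro x
    rw [norm_mul, Real.norm_eq_abs, Real.norm_of_nonneg (gaussKernel_nonneg hv _), ← add_mul,
      ← mul_assoc]
    exact mul_le_mul_of_nonneg_right (abs_sq_norm_baranchik_sub_le hr ha x μ)
      (gaussKernel_nonneg hv _)
  have hi : Integrable fun x =>
      (‖baranchik a r x - μ‖ ^ 2 - ‖x - μ‖ ^ 2) * gaussKernel p v (x - μ) :=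
    Integrable.mono' i3 (by fun_prop : Measurable fun x =>
      (‖baranchik a r x - μ‖ ^ 2 - ‖x - μ‖ ^ 2) * gaussKernel p v (x - μ)).aestronglyMeasurable
      (Filter.Eventually.of_forall hb)
  refine ⟨hi, (integral_mono hi.norm i3 hb).trans ?_⟩
  rw [integral_const_mul, integral_add i1 i2, integral_sq_norm_sub_mul_gaussKernel hv]
  have h1 := shrinkMean_le_div isShrinkage_one hp μ hv
  rw [mul_comm, ← le_div_iff₀ hv, shrinkMean, div_eq_mul_inv] at h1
  refine mul_le_mul_of_nonneg_left ?_ (by positivity)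
  linarith

/-- Conditional risk difference of Baranchik estimators given the mixing variance. -/
theorem integral_sq_norm_baranchik_sub_le (hr : IsShrinkage r) (hp : 2 < p) {a : ℝ}
    (ha : 0 ≤ a) {v : ℝ} (hv : 0 < v) (μ : EuclideanSpace ℝ (Fin p)) :
    ∫ x, (‖baranchik a r x - μ‖ ^ 2 - ‖x - μ‖ ^ 2) * gaussKernel p v (x - μ)
      ≤ a * (v * shrinkMean r μ v) * (a * v⁻¹ - 2 * ((p : ℝ) - 2)) := by
  have i1 := (hr.integrable_profile hp 1 hv μ).const_mul (a ^ 2)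
  have i2 := (integrable_profile_mul_inner hr hp hv μ).const_mul (2 * a)
  have hS := stein_inequality hr hp hv μ
  calc _ ≤ ∫ x, (a ^ 2 * (shrinkProfile r 1 ‖x‖ * gaussKernel p v (x - μ))
        - 2 * a * (shrinkProfile r 1 ‖x‖ * inner ℝ x (x - μ) * gaussKernel p v (x - μ))) := by
        refine integral_mono (integrable_sq_norm_baranchik_sub_mul hr hp ha hv μ).1
          (i1.sub i2) fun x => ?_
        simp only
        rw [sq_norm_baranchik_sub]
        have h1 := mul_le_mul_of_nonneg_left (mul_le_mul_of_nonneg_right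
          (profile_sq_mul_le hr x) (gaussKernel_nonneg hv (x - μ))) (sq_nonneg a)
        linarith
    _ = a ^ 2 * shrinkMean r μ v - 2 * a *
        ∫ x, shrinkProfile r 1 ‖x‖ * inner ℝ x (x - μ) * gaussKernel p v (x - μ) := by
        rw [integral_sub i1 i2, integral_const_mul, integral_const_mul, shrinkMean]
    _ ≤ a ^ 2 * shrinkMean r μ v - 2 * a * (((p : ℝ) - 2) * (v * shrinkMean r μ v)) := by
        have := mul_le_mul_of_nonneg_left hS (by positivity : 0 ≤ 2 * a)
        linarith
    _ = _ := by field_simp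

/-- `v₀` is the zero of `a/v - 2(p-2)`. Freezing the monotone factor `v m(v)` at `v₀` leaves a bound
linear in `1/v`, ready for integration over the mixing law. -/
theorem integral_sq_norm_baranchik_sub_le_const (hr : IsShrinkage r) (hp : 2 < p) {a : ℝ}
    (ha : 0 < a) {v : ℝ} (hv : 0 < v) (μ : EuclideanSpace ℝ (Fin p)) {v₀ : ℝ}
    (hv₀ : v₀ = a / (2 * ((p : ℝ) - 2))) :
    ∫ x, (‖baranchik a r x - μ‖ ^ 2 - ‖x - μ‖ ^ 2) * gaussKernel p v (x - μ)
      ≤ a * (v₀ * shrinkMean r μ v₀) * (a * v⁻¹ - 2 * ((p : ℝ) - 2)) := by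
  have hp' : (0 : ℝ) < (p : ℝ) - 2 := by
    have : (2 : ℝ) < p := by exact_mod_cast hp
    linarith
  have hv₀0 : 0 < v₀ := by rw [hv₀]; positivity
  have hav : a = v₀ * (2 * ((p : ℝ) - 2)) := by rw [hv₀]; field_simp
  refine (integral_sq_norm_baranchik_sub_le hr hp ha.le hv μ).trans ?_
  rw [mul_assoc a (v * _), mul_assoc a (v₀ * _)]
  refine mul_le_mul_of_nonneg_left ?_ ha.le
  -- Below `v₀` the last factor is non-negative and `v m(v)` lies under its value at `v₀`; above
  -- `v₀` both signs reverse.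
  rcases le_total v v₀ with h | h
  · refine mul_le_mul_of_nonneg_right (mul_shrinkMean_mono hr hp μ hv h) ?_
    rw [sub_nonneg, ← div_eq_mul_inv, le_div_iff₀ hv, mul_comm, hav]
    gcongr
  · refine mul_le_mul_of_nonpos_right (mul_shrinkMean_mono hr hp μ hv₀0 h) ?_
    rw [sub_nonpos, ← div_eq_mul_inv, div_le_iff₀ hv, hav, mul_comm]
    gcongr

/-- Baranchik estimators under quadratic loss for scale mixtures of normals. -/
theorem integral_sq_norm_baranchik_sub_nonpos (hr : IsShrinkage r) (hp : 2 < p) {a : ℝ}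
    (ha : 0 < a) {J : Measure ℝ} [IsProbabilityMeasure J] (hJ : ∀ᵐ v ∂J, 0 < v)
    (hinv : Integrable (fun v => v⁻¹) J) (hid : Integrable (fun v => v) J)
    (hbound : a * ∫ v, v⁻¹ ∂J ≤ 2 * ((p : ℝ) - 2)) (μ : EuclideanSpace ℝ (Fin p)) :
    Integrable (fun x => snDensity p J (x - μ) *
      (‖baranchik a r x - μ‖ ^ 2 - ‖x - μ‖ ^ 2)) ∧
    ∫ x, snDensity p J (x - μ) * (‖baranchik a r x - μ‖ ^ 2 - ‖x - μ‖ ^ 2) ≤ 0 := by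
  have hm := hr.measurable_baranchik (p := p) a
  have hp' : (0 : ℝ) < (p : ℝ) - 2 := by
    have : (2 : ℝ) < p := by exact_mod_cast hp
    linarith
  set F : ℝ → EuclideanSpace ℝ (Fin p) → ℝ := fun v x =>
    (‖baranchik a r x - μ‖ ^ 2 - ‖x - μ‖ ^ 2) * gaussKernel p v (x - μ) with hF
  have hFm : Measurable (Function.uncurry F) := by
    unfold Function.uncurry; simp only [hF]; fun_prop
  have hFi : Integrable (Function.uncurry F) (J.prod volume) := by
    rw [integrable_prod_iff hFm.aestronglyMeasurable]
    refine ⟨?_, ?_⟩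
    · filter_upwards [hJ] with v hv
      exact (integrable_sq_norm_baranchik_sub_mul hr hp ha.le hv μ).1
    · refine Integrable.mono' (((hinv.const_mul
        (∫ y : EuclideanSpace ℝ (Fin p), (‖y‖ ^ 2)⁻¹ * gaussKernel p 1 y)).add
        (hid.const_mul (∫ y : EuclideanSpace ℝ (Fin p), ‖y‖ ^ 2 * gaussKernel p 1 y))).const_mul
        (a ^ 2 + 2 * a))
        (hFm.norm.stronglyMeasurable.integral_prod_right (ν := volume)).aestronglyMeasurable ?_
      filter_upwards [hJ] with v hv
      rw [Real.norm_of_nonneg (integral_nonneg fun _ => norm_nonneg _)]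
      exact (integrable_sq_norm_baranchik_sub_mul hr hp ha.le hv μ).2
  have e : ∀ x, snDensity p J (x - μ) * (‖baranchik a r x - μ‖ ^ 2 - ‖x - μ‖ ^ 2)
      = ∫ v, F v x ∂J := by
    intro x
    rw [snDensity_eq_integral, mul_comm, ← integral_const_mul]
  simp only [e]
  refine ⟨hFi.integral_prod_right, ?_⟩
  rw [← integral_integral_swap hFi]
  set v₀ := a / (2 * ((p : ℝ) - 2)) with hv₀
  have hv₀0 : 0 < v₀ := by positivity
  have hk : 0 ≤ a * (v₀ * shrinkMean r μ v₀) :=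
    mul_nonneg ha.le (mul_nonneg hv₀0.le (shrinkMean_nonneg hr μ hv₀0))
  have hlin : Integrable (fun v => a * v⁻¹ - 2 * ((p : ℝ) - 2)) J :=
    (hinv.const_mul a).sub (integrable_const _)
  calc ∫ v, (∫ x, F v x) ∂J
      ≤ ∫ v, a * (v₀ * shrinkMean r μ v₀) * (a * v⁻¹ - 2 * ((p : ℝ) - 2)) ∂J := by
        refine integral_mono_ae hFi.integral_prod_left (hlin.const_mul _) ?_
        filter_upwards [hJ] with v hv
        exact integral_sq_norm_baranchik_sub_le_const hr hp ha hv μ hv₀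
    _ = a * (v₀ * shrinkMean r μ v₀) * (a * ∫ v, v⁻¹ ∂J - 2 * ((p : ℝ) - 2)) := by
        rw [integral_const_mul, integral_sub (hinv.const_mul a) (integrable_const _),
          integral_const_mul]
        simp
    _ ≤ 0 := mul_nonpos_of_nonneg_of_nonpos hk (by linarith)

/-- For large `‖x‖` the shrinking factor lies strictly between `0` and `1`, so norms strictly
decrease on a nonempty open set. -/
theorem not_ae_norm_baranchik_eq (hr : IsShrinkage r) (hp : 0 < p) {a : ℝ} (ha : 0 < a) {t₀ : ℝ}
    (ht₀ : 0 < r t₀) : ¬ ∀ᵐ x : EuclideanSpace ℝ (Fin p), ‖baranchik a r x - 0‖ = ‖x - 0‖ := by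
  intro h
  have : Nonempty (Fin p) := ⟨⟨0, hp⟩⟩
  let U : Set (EuclideanSpace ℝ (Fin p)) := {x | max t₀ a < ‖x‖ ^ 2}
  have hU : IsOpen U := isOpen_lt continuous_const (by fun_prop)
  have hUne : U.Nonempty := by
    refine ⟨EuclideanSpace.single ⟨0, hp⟩ (|max t₀ a| + 1), ?_⟩
    simp only [U, Set.mem_ofPred_eq, PiLp.norm_single, Real.norm_eq_abs, sq_abs]
    nlinarith [le_abs_self (max t₀ a), abs_nonneg (max t₀ a)]
  have hUpos := hU.measure_pos volume hUne
  refine hUpos.ne' (measure_mono_null (fun x hx => ?_) h)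
  have hx' : max t₀ a < ‖x‖ ^ 2 := hx
  have h1 : t₀ < ‖x‖ ^ 2 := (le_max_left _ _).trans_lt hx'
  have h2 : a < ‖x‖ ^ 2 := (le_max_right _ _).trans_lt hx'
  have hpos : 0 < ‖x‖ ^ 2 := ha.trans h2
  have hn : 0 < ‖x‖ := by
    rcases (norm_nonneg x).eq_or_lt with h0 | h0
    · rw [← h0] at hpos; norm_num at hpos
    · exact h0
  have hrpos : 0 < r (‖x‖ ^ 2) := ht₀.trans_le (hr.mono h1.le)
  have hc0 : 0 < a * r (‖x‖ ^ 2) / ‖x‖ ^ 2 := by positivity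
  have hc1 : a * r (‖x‖ ^ 2) / ‖x‖ ^ 2 < 1 := by
    rw [div_lt_one hpos]
    calc _ ≤ a * 1 := by gcongr; exact hr.le_one _
      _ < _ := by linarith
  simp only [Set.mem_compl_iff, Set.mem_ofPred_eq, sub_zero]
  rw [baranchik, norm_smul, Real.norm_of_nonneg (by linarith)]
  intro heq
  nlinarith

/-- Extension by `0` makes `r` monotone on the whole line, and hence measurable. -/
theorem exists_isShrinkage_eq {r : ℝ → ℝ} (h01 : ∀ t, 0 < t → 0 ≤ r t ∧ r t ≤ 1)
    (hmono : MonotoneOn r (Set.Ioi 0)) (hanti : AntitoneOn (fun t => r t / t) (Set.Ioi 0)) :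
    ∃ r' : ℝ → ℝ, IsShrinkage r' ∧ ∀ t, 0 < t → r' t = r t := by
  classical
  refine ⟨fun t => if 0 < t then r t else 0, ⟨?_, ?_, ?_, ?_⟩, fun t ht => if_pos ht⟩
  · intro s t hst
    simp only
    split_ifs with h1 h2 h2
    · exact hmono h1 h2 hst
    · exact absurd (h1.trans_le hst) h2
    · exact (h01 t h2).1
    · exact le_rfl
  · intro t
    split_ifs with h
    · exact (h01 t h).1
    · exact le_rfl
  · intro t
    split_ifs with h
    · exact (h01 t h).2
    · exact zero_le_one
  · intro s hs t ht hst
    have hs' : (0 : ℝ) < s := hs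
    have ht' : (0 : ℝ) < t := ht
    simp only [if_pos hs', if_pos ht']
    exact hanti hs ht hst

theorem baranchik_congr (a : ℝ) {r r' : ℝ → ℝ} (h : ∀ t, 0 < t → r' t = r t) :
    baranchik (p := p) a r = baranchik a r' := by
  funext x
  rcases eq_or_ne x 0 with rfl | hx
  · simp [baranchik]
  · have : 0 < ‖x‖ := norm_pos_iff.2 hx
    rw [baranchik, baranchik, h _ (by positivity)]

theorem dominates_plugIn_baranchik {G H : Measure ℝ} (hp : 4 ≤ p) (hG : IsMixing p G)
    (hH : IsMixing p H) (hr : IsShrinkage r) {t₀ : ℝ} (ht₀ : 0 < r t₀)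
    (h12 : Integrable (fun z : ℝ => z ^ (1 / 2 : ℝ)) (lawZ p G H))
    (h32 : Integrable (fun z : ℝ => z ^ (-3 / 2 : ℝ)) (lawZ p G H)) {a : ℝ} (ha : 0 < a)
    (hle : a ≤ 2 * ((p : ℝ) - 3) * ((∫ z, z ^ (-1 / 2 : ℝ) ∂(lawZ p G H)) /
        ∫ z, z ^ (-3 / 2 : ℝ) ∂(lawZ p G H))) :
    Dominates
      (l1Risk (snDensity p G) (snDensity p H) (plugIn (snDensity p H) (baranchik a r)))
      (l1Risk (snDensity p G) (snDensity p H) (plugIn (snDensity p H) fun x => x)) := by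
  have hp1 : 1 < p := by omega
  have hp' : (4 : ℝ) ≤ p := by exact_mod_cast hp
  have hF := isMixing_lawZ (by omega) hG hH
  have := hF.isProb
  have : IsProbabilityMeasure (starLaw p G H) := isProbabilityMeasure_divNormLaw hp1 hF
  have hJ : ∀ᵐ v ∂(starLaw p G H), 0 < v := divNormLaw_pos hF
  have hinv : Integrable (fun v => v⁻¹) (starLaw p G H) := by
    have e : (-1 : ℝ) - 1 / 2 = -3 / 2 := by norm_num
    rw [starLaw]
    simpa only [Real.rpow_neg_one] using
      integrable_divNormLaw_rpow hp1 hF (t := -1) (by rwa [e]) (by linarith)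
  have hid : Integrable (fun v => v) (starLaw p G H) := by
    have e : (1 : ℝ) - 1 / 2 = 1 / 2 := by norm_num
    rw [starLaw]
    simpa only [Real.rpow_one] using
      integrable_divNormLaw_rpow hp1 hF (t := 1) (by rwa [e]) (by linarith)
  have hbound : a * ∫ v, v⁻¹ ∂(starLaw p G H) ≤ 2 * ((p : ℝ) - 2) := by
    have e1 := integral_rpow_pos hF.pos (hF.integrable_rpow (t := -1 / 2) (by norm_num)
      (by linarith))
    have e3 := integral_rpow_pos hF.pos h32
    have h3 : (0 : ℝ) < p - 3 := by linarith
    have h2 : (0 : ℝ) < p - 2 := by linarith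
    -- The factor `(p-2)/(p-3)` in `E_J(1/V)` turns the bound on `a` into exactly `2(p-2)`.
    rw [starLaw, integral_inv_divNormLaw hp hF h32]
    refine (mul_le_mul_of_nonneg_right hle (by positivity)).trans (le_of_eq ?_)
    generalize ∫ z, z ^ (-1 / 2 : ℝ) ∂(lawZ p G H) = A at e1 ⊢
    generalize ∫ z, z ^ (-3 / 2 : ℝ) ∂(lawZ p G H) = B at e3 ⊢
    field_simp
  have hmain := integral_sq_norm_baranchik_sub_nonpos hr (by omega) ha hJ hinv hid hbound
  have hpm := measurable_pStar (by omega) hG hH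
  have hps := pStar_nonneg (p := p) hG hH
  have hae : ∀ μ : EuclideanSpace ℝ (Fin p),
      (fun x => snDensity p (starLaw p G H) (x - μ) *
        (‖baranchik a r x - μ‖ ^ 2 - ‖x - μ‖ ^ 2)) =ᵐ[volume]
      fun x => pStar p G H (x - μ) * (‖baranchik a r x - μ‖ ^ 2 - ‖x - μ‖ ^ 2) := by
    intro μ
    filter_upwards [ae_ne_euclidean (by omega) μ] with x hx
    rw [pStar_eq_snDensity hp1 hG hH (sub_ne_zero.2 hx)]
  have hcomp := fun μ => l1Risk_plugIn_comparison hp1 hG hH (hr.measurable_baranchik a) (μ := μ)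
    ((integrable_locationLaw hpm hps).2 ((hmain μ).1.congr (hae μ)))
    (by rw [integral_locationLaw hpm hps, ← integral_congr_ae (hae μ)]; exact (hmain μ).2)
  -- Strictness is claimed at `μ = 0` through the second alternative, since the quadratic comparison
  -- need not be strict.
  exact ⟨fun μ => (hcomp μ).1,
    0, (hcomp 0).2 (Or.inr (not_ae_norm_baranchik_eq hr (by omega) ha ht₀))⟩
end

theorem theorem5p2 (p : ℕ) (hp : 1 < p) (G H : Measure ℝ)
    (hG : IsMixing p G) (hH : IsMixing p H) :
    -- `p*` is a scale mixture of normals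
    (∃ J : Measure ℝ, IsProbabilityMeasure J ∧ (∀ᵐ v ∂J, 0 < v) ∧
      ∀ s : EuclideanSpace ℝ (Fin p), s ≠ 0 → pStar p G H s = snDensity p J s) ∧
    -- part (a)
    (∀ δ : EuclideanSpace ℝ (Fin p) → EuclideanSpace ℝ (Fin p), Measurable δ →
      (∀ μ, sqRisk (pStar p G H) (fun x => x) μ < ∞) →
      Dominates (sqRisk (pStar p G H) δ) (sqRisk (pStar p G H) fun x => x) →
      Dominates
        (l1Risk (snDensity p G) (snDensity p H) (plugIn (snDensity p H) δ))
        (l1Risk (snDensity p G) (snDensity p H) (plugIn (snDensity p H) fun x => x))) ∧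
    -- part (b)
    (4 ≤ p → ∀ (r : ℝ → ℝ) (a : ℝ),
      (∀ t, 0 < t → 0 ≤ r t ∧ r t ≤ 1) → (∃ t, 0 < t ∧ r t ≠ 0) →
      MonotoneOn r (Set.Ioi 0) → AntitoneOn (fun t => r t / t) (Set.Ioi 0) →
      Integrable (fun z : ℝ => z ^ (1 / 2 : ℝ)) (lawZ p G H) →
      Integrable (fun z : ℝ => z ^ (-3 / 2 : ℝ)) (lawZ p G H) →
      0 < a →
      a ≤ 2 * ((p : ℝ) - 3) * ((∫ z, z ^ (-1 / 2 : ℝ) ∂(lawZ p G H)) /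
        ∫ z, z ^ (-3 / 2 : ℝ) ∂(lawZ p G H)) →
      Dominates
        (l1Risk (snDensity p G) (snDensity p H) (plugIn (snDensity p H) (baranchik a r)))
        (l1Risk (snDensity p G) (snDensity p H) (plugIn (snDensity p H) fun x => x))) := by
  refine ⟨⟨starLaw p G H, isProbabilityMeasure_divNormLaw hp (isMixing_lawZ (by omega) hG hH),
    divNormLaw_pos (isMixing_lawZ (by omega) hG hH), fun s hs => pStar_eq_snDensity hp hG hH hs⟩,
    fun δ hδ hfin hdom => dominates_plugIn_of_dominates_sqRisk hp hG hH hδ hfin hdom, ?_⟩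
  intro hp4 r a h01 hne hmono hanti h12 h32 ha hle
  obtain ⟨r', hr', hrr'⟩ := exists_isShrinkage_eq h01 hmono hanti
  obtain ⟨t, ht, hrt⟩ := hne
  rw [baranchik_congr a hrr']
  refine dominates_plugIn_baranchik hp4 hG hH hr' (t₀ := t) ?_ h12 h32 ha hle
  rw [hrr' t ht]
  exact lt_of_le_of_ne (h01 t ht).1 (Ne.symm hrt)
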